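/- Let $M$ be a finite-dimensional paracompact (Hausdorff) $C^\infty$ manifold, and let $L$ be a smooth vector $1$-form on $M$ (a smooth field of endomorphisms of the tangent spaces) with vanishing Nijenhuis tensor $\tfrac12[L,L]=0$ and with $\operatorname{Im} L_z=\operatorname{Ker} L_z$ for every $z\in M$, where $[\cdot,\cdot]$ is the Frölicher–Nijenhuis bracket. Let $\Gamma$ be an $L$-connection on $M$, i.e. a smooth vector $1$-form with $L\Gamma=L$ and $\Gamma L=-L$. Let $h=\tfrac12(I+\Gamma)$ be its horizontal projector, $H_z=\operatorname{Im}h_z$ the horizontal space at $z$, $R=-\tfrac12[h,h]$ the curvature of $\Gamma$, $N_R(z)=\{X\in H_z : i_XR=0\}$ the nullity space of $R$ at $z$, and $\mu_R(z)=\dim N_R(z)$ the nullity index. If $\mu_R$ is constant on an open set $U\subset M$, then the nullity distribution $N_R$ is completely integrable on $U$: every point of $U$ has a neighbourhood in $U$ with smooth coordinates $(x^1,\dots,x^{d})$ of $M$, where $d=\dim M$, in which, at every point $z$, $N_R(z)$ is spanned by $\partial/\partial x^1,\dots,\partial/\partial x^k$, where $k$ is the constant value of $\mu_R$ on $U$.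 -/

import Mathlib

open scoped Manifold ContDiff

noncomputable section

namespace LConn

section Forms

variable {E : Type*} [NormedAddCommGroup E] [NormedSpace ℝ E]
  {M : Type*} [TopologicalSpace M] [ChartedSpace E M]

/-- Vector fields on `M`, with no regularity assumed. -/
abbrev VField (E : Type*) [NormedAddCommGroup E] [NormedSpace ℝ E]
    (M : Type*) [TopologicalSpace M] [ChartedSpace E M] : Type _ :=
  (z : M) → TangentSpace 𝓘(ℝ, E) z

/-- Smooth vector `1`-forms on `M`: smooth fields of endomorphisms of the tangent spaces. -/
abbrev VectorOneForm (E : Type*) [NormedAddCommGroup E] [NormedSpace ℝ E]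
    (M : Type*) [TopologicalSpace M] [ChartedSpace E M] [IsManifold 𝓘(ℝ, E) ∞ M] : Type _ :=
  Cₛ^∞⟮𝓘(ℝ, E); E →L[ℝ] E,
    fun z : M => TangentSpace 𝓘(ℝ, E) z →L[ℝ] TangentSpace 𝓘(ℝ, E) z⟯

variable [IsManifold 𝓘(ℝ, E) ∞ M]

/-- The vector field `K X` obtained by applying a vector `1`-form to a vector field. -/
def VectorOneForm.app (K : VectorOneForm E M) (X : VField E M) : VField E M :=
  fun z => K z (X z)

/-- The identity vector `1`-form. -/
def idForm (E : Type*) [NormedAddCommGroup E] [NormedSpace ℝ E]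
    (M : Type*) [TopologicalSpace M] [ChartedSpace E M] [IsManifold 𝓘(ℝ, E) ∞ M] :
    VectorOneForm E M where
  toFun z := ContinuousLinearMap.id ℝ (TangentSpace 𝓘(ℝ, E) z)
  contMDiff_toFun := by
    intro z₀
    rw [contMDiffAt_hom_bundle]
    refine ⟨contMDiffAt_id, ?_⟩
    refine (contMDiffAt_const (c := ContinuousLinearMap.id ℝ E)).congr_of_eventuallyEq ?_
    have hmem : (trivializationAt E (TangentSpace 𝓘(ℝ, E)) z₀).baseSet ∈ nhds z₀ :=
      (trivializationAt E (TangentSpace 𝓘(ℝ, E)) z₀).open_baseSet.mem_nhds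
        (FiberBundle.mem_baseSet_trivializationAt' z₀)
    filter_upwards [hmem] with z hz
    ext v
    simp only [ContinuousLinearMap.inCoordinates, ContinuousLinearMap.id_comp,
      ContinuousLinearMap.comp_apply, ContinuousLinearMap.id_apply]
    exact (trivializationAt E (TangentSpace 𝓘(ℝ, E)) z₀).continuousLinearMapAt_symmL hz v

open VectorField in
/-- The Frölicher-Nijenhuis bracket of two vector `1`-forms, evaluated on two vector fields
at a point. -/
def fnBracketField (K K' : VectorOneForm E M) (X Y : VField E M) (z : M) :
    TangentSpace 𝓘(ℝ, E) z :=
  mlieBracket 𝓘(ℝ, E) (K.app X) (K'.app Y) z + mlieBracket 𝓘(ℝ, E) (K'.app X) (K.app Y) z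
    + K z (K' z (mlieBracket 𝓘(ℝ, E) X Y z)) + K' z (K z (mlieBracket 𝓘(ℝ, E) X Y z))
    - K z (mlieBracket 𝓘(ℝ, E) (K'.app X) Y z) - K z (mlieBracket 𝓘(ℝ, E) X (K'.app Y) z)
    - K' z (mlieBracket 𝓘(ℝ, E) (K.app X) Y z) - K' z (mlieBracket 𝓘(ℝ, E) X (K.app Y) z)

theorem VectorOneForm.app_mdifferentiableAt (K : VectorOneForm E M) {X : VField E M} {z : M}
    (hX : MDiffAt (T% X) z) : MDiffAt (T% (K.app X)) z :=
  MDifferentiableAt.clm_bundle_apply ((K.contMDiff z).mdifferentiableAt (by simp)) hX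

theorem VectorOneForm.app_smul (K : VectorOneForm E M) (f : M → ℝ) (X : VField E M) :
    K.app (f • X) = f • K.app X := by
  funext z; simp [VectorOneForm.app]

theorem VectorOneForm.app_add (K : VectorOneForm E M) (X Y : VField E M) :
    K.app (X + Y) = K.app X + K.app Y := by
  funext z; simp [VectorOneForm.app]

variable [FiniteDimensional ℝ E]

theorem fnBracketField_tensorial_left (K K' : VectorOneForm E M) (z : M) (Y : VField E M) :
    TensorialAt 𝓘(ℝ, E) E (fun X => fnBracketField K K' X Y z) z := by
  have : CompleteSpace E := FiniteDimensional.complete ℝ E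
  constructor
  · intro f X hf hX
    have h1 := K.app_mdifferentiableAt hX
    have h2 := K'.app_mdifferentiableAt hX
    simp only [fnBracketField, VectorOneForm.app_smul,
      VectorField.mlieBracket_smul_left hf hX, VectorField.mlieBracket_smul_left hf h1,
      VectorField.mlieBracket_smul_left hf h2, map_add, map_smul]
    simp only [VectorOneForm.app]
    module
  · intro X X' hX hX'
    have h1 := K.app_mdifferentiableAt hX
    have h2 := K'.app_mdifferentiableAt hX
    have h1' := K.app_mdifferentiableAt hX'
    have h2' := K'.app_mdifferentiableAt hX'
    simp only [fnBracketField, VectorOneForm.app_add,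
      VectorField.mlieBracket_add_left hX hX', VectorField.mlieBracket_add_left h1 h1',
      VectorField.mlieBracket_add_left h2 h2', map_add]
    module

theorem fnBracketField_tensorial_right (K K' : VectorOneForm E M) (z : M) (X : VField E M) :
    TensorialAt 𝓘(ℝ, E) E (fun Y => fnBracketField K K' X Y z) z := by
  have : CompleteSpace E := FiniteDimensional.complete ℝ E
  constructor
  · intro f Y hf hY
    have h1 := K.app_mdifferentiableAt hY
    have h2 := K'.app_mdifferentiableAt hY
    simp only [fnBracketField, VectorOneForm.app_smul,
      VectorField.mlieBracket_smul_right hf hY, VectorField.mlieBracket_smul_right hf h1,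
      VectorField.mlieBracket_smul_right hf h2, map_add, map_smul]
    simp only [VectorOneForm.app]
    module
  · intro Y Y' hY hY'
    have h1 := K.app_mdifferentiableAt hY
    have h2 := K'.app_mdifferentiableAt hY
    have h1' := K.app_mdifferentiableAt hY'
    have h2' := K'.app_mdifferentiableAt hY'
    simp only [fnBracketField, VectorOneForm.app_add,
      VectorField.mlieBracket_add_right hY hY', VectorField.mlieBracket_add_right h1 h1',
      VectorField.mlieBracket_add_right h2 h2', map_add]
    module

/-- The Frölicher-Nijenhuis bracket `[K, K']` of two vector `1`-forms, as a vector `2`-form. -/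
def fnBracket (K K' : VectorOneForm E M) (z : M) :
    TangentSpace 𝓘(ℝ, E) z →L[ℝ] TangentSpace 𝓘(ℝ, E) z →L[ℝ] TangentSpace 𝓘(ℝ, E) z :=
  TensorialAt.mkHom₂ (fun X Y => fnBracketField K K' X Y z) z
    (fun Y _ => fnBracketField_tensorial_left K K' z Y)
    (fun X _ => fnBracketField_tensorial_right K K' z X)

/-- `[K, K']` takes the expected value on all vector fields that are differentiable at `z`. -/
theorem fnBracket_apply (K K' : VectorOneForm E M) {X Y : VField E M} {z : M}
    (hX : MDiffAt (T% X) z) (hY : MDiffAt (T% Y) z) :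
    fnBracket K K' z (X z) (Y z) = fnBracketField K K' X Y z :=
  TensorialAt.mkHom₂_apply (Φ := fun X Y => fnBracketField K K' X Y z) _ _ hX hY

/-- `L` has vanishing Nijenhuis tensor `½[L, L]`, and its image and kernel coincide at every
point. (The latter forces `dim M = 2n` and `rank L = n`.) -/
structure IsAlmostTangent (L : VectorOneForm E M) : Prop where
  nijenhuis_eq_zero : ∀ z, (1 / 2 : ℝ) • fnBracket L L z = 0
  range_eq_ker : ∀ z, LinearMap.range (L z).toLinearMap = LinearMap.ker (L z).toLinearMap

/-- `Γ` is an `L`-connection: `L Γ = L` and `Γ L = -L`. -/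
structure IsConnection (L Γ : VectorOneForm E M) : Prop where
  comp_left : ∀ z, (L z).comp (Γ z) = L z
  comp_right : ∀ z, (Γ z).comp (L z) = -L z

/-- The horizontal projector `h = ½(I + Γ)`. -/
def horProj (Γ : VectorOneForm E M) : VectorOneForm E M :=
  (1 / 2 : ℝ) • (idForm E M + Γ)

/-- The horizontal space `H_z = Im h_z`. -/
def horSpace (Γ : VectorOneForm E M) (z : M) : Submodule ℝ (TangentSpace 𝓘(ℝ, E) z) :=
  LinearMap.range (horProj Γ z).toLinearMap

/-- The curvature `R = -½[h, h]`. -/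
def curvature (Γ : VectorOneForm E M) (z : M) :
    TangentSpace 𝓘(ℝ, E) z →L[ℝ] TangentSpace 𝓘(ℝ, E) z →L[ℝ] TangentSpace 𝓘(ℝ, E) z :=
  -((1 / 2 : ℝ) • fnBracket (horProj Γ) (horProj Γ) z)

/-- The nullity space `N_R(z) = {X ∈ H_z : i_X R = 0}` of the curvature. -/
def nullity (Γ : VectorOneForm E M) (z : M) : Submodule ℝ (TangentSpace 𝓘(ℝ, E) z) :=
  horSpace Γ z ⊓ LinearMap.ker (curvature Γ z).toLinearMap

theorem mem_nullity (Γ : VectorOneForm E M) (z : M) (u : TangentSpace 𝓘(ℝ, E) z) :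
    u ∈ nullity Γ z ↔ u ∈ horSpace Γ z ∧ curvature Γ z u = 0 :=
  Iff.rfl

/-- The nullity index `μ_R(z) = dim N_R(z)`. -/
def nullityIndex (Γ : VectorOneForm E M) (z : M) : ℕ :=
  Module.finrank ℝ (nullity Γ z)

end Forms

/-- A field `D` of tangent subspaces is completely integrable on `U` if every point of `U` lies
in the domain, contained in `U`, of a smooth chart `φ` of `M` that is flat for `D`: at every
point `z` of the domain, `D z` is the subspace of `T_z M` that `dφ_z` identifies with one fixed
subspace `F` of the model space. After a linear change of the coordinates `φ`, this says that
`D` is spanned by the first `dim F` coordinate vector fields. -/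
def IsCompletelyIntegrableOn {E : Type*} [NormedAddCommGroup E] [NormedSpace ℝ E]
    {M : Type*} [TopologicalSpace M] [ChartedSpace E M]
    (D : (z : M) → Submodule ℝ (TangentSpace 𝓘(ℝ, E) z)) (U : Set M) : Prop :=
  ∀ p ∈ U, ∃ φ ∈ IsManifold.maximalAtlas 𝓘(ℝ, E) ∞ M, p ∈ φ.source ∧ φ.source ⊆ U ∧
    ∃ F : Submodule ℝ E, ∀ z ∈ φ.source, ∀ u : TangentSpace 𝓘(ℝ, E) z,
      u ∈ D z ↔ (mfderiv 𝓘(ℝ, E) 𝓘(ℝ, E) φ z u : E) ∈ F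

end LConn

end

open scoped Topology

namespace LConn

-- The relations between `L` and `Γ` give `Γ² = I`, so in a chart `h` is a smooth field `H` of
-- projectors. For fields fixed by `H` the curvature is `R(X, Y) = H[X, Y] - [X, Y]`, and `R`
-- vanishes on a pair of a horizontal and a vertical vector (`flatCurvature_apply_of_fixed`,
-- `flatCurvature_apply_fixed_killed`). Hence bracketing with a nullity field preserves horizontal
-- fields. For nullity fields `X`, `Y` and horizontal `Z`, Jacobi gives `[[X, Y], Z] = [X, [Y, Z]] -
-- [Y, [X, Z]]`, which is horizontal, so `R([X, Y], Z) = 0`: the nullity distribution is involutive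
-- (`lieBracket_mem_nullity`).
--
-- It remains to prove Frobenius' theorem for kernels of constant dimension
-- (`exists_flat_openPartialHomeomorph`). Locally such kernels are graphs of maps `a`, and integral
-- leaves solve `dy = a(x, y) dx`. This is solved along the rays `s ↦ s x`; smooth dependence on the
-- data comes from the inverse function theorem in a space of continuous curves. Involutivity makes
-- the ray solutions satisfy the full equation, by a Grönwall estimate
-- (`variation_eq_of_totallyIntegrableOn`), and the inverse of `(x, y₀) ↦ (x, y(x))`, with `y₀` the
-- value at `0`, flattens the distribution.

universe u

/-! ### Smoothness of postcomposition on spaces of continuous functions -/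

section Postcomposition

variable {K : Type*} [TopologicalSpace K] [CompactSpace K]
  {E F : Type u} [NormedAddCommGroup E] [NormedSpace ℝ E]
  [NormedAddCommGroup F] [NormedSpace ℝ F]

/-- Pointwise application of a continuous family of continuous linear maps to a continuous
family of vectors. -/
noncomputable def pointwiseApply (K : Type*) [TopologicalSpace K] [CompactSpace K]
    (E F : Type*) [NormedAddCommGroup E] [NormedSpace ℝ E]
    [NormedAddCommGroup F] [NormedSpace ℝ F] :
    C(K, E →L[ℝ] F) →L[ℝ] C(K, E) →L[ℝ] C(K, F) :=
  LinearMap.mkContinuous₂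
    (LinearMap.mk₂ ℝ (fun (A : C(K, E →L[ℝ] F)) (g : C(K, E)) =>
        (⟨fun t => A t (g t), A.continuous.clm_apply g.continuous⟩ : C(K, F)))
      (fun _ _ _ => by ext; simp) (fun _ _ _ => by ext; simp)
      (fun _ _ _ => by ext; simp) (fun _ _ _ => by ext; simp))
    1 (fun A g => by
      rw [ContinuousMap.norm_le _ (by positivity)]
      intro t
      rw [one_mul]
      exact (A t).le_of_opNorm_le_of_le (A.norm_coe_le_norm t) (g.norm_coe_le_norm t))

@[simp] theorem pointwiseApply_apply (A : C(K, E →L[ℝ] F)) (g : C(K, E)) (t : K) :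
    pointwiseApply K E F A g t = A t (g t) := rfl

theorem hasFDerivAt_postcomp {f : C(E, F)} {f' : C(E, E →L[ℝ] F)}
    (hf : ∀ x, HasFDerivAt f (f' x) x) (g : C(K, E)) :
    HasFDerivAt (fun g : C(K, E) => f.comp g) (pointwiseApply K E F (f'.comp g)) g := by
  rw [hasFDerivAt_iff_isLittleO, Asymptotics.isLittleO_iff]
  intro ε hε
  have hcont : Continuous fun g : C(K, E) => f'.comp g := ContinuousMap.continuous_postcomp f'
  obtain ⟨δ, hδ, H⟩ := (Metric.continuous_iff (α := C(K, E)) (β := C(K, E →L[ℝ] F))).1 hcont g ε hε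
  filter_upwards [Metric.ball_mem_nhds g hδ] with g₁ hg₁
  rw [ContinuousMap.norm_le _ (by positivity)]
  intro t
  -- Shifting `g` by the constant `y - g t` moves its value at `t` to `y`. Continuity of
  -- postcomposition with `f'` thus gives one `δ` for all `t`, replacing uniform continuity of `f'`
  -- near the image of `g`.
  have hball : ∀ y ∈ Metric.ball (g t) δ, ‖f' y - f' (g t)‖ ≤ ε := by
    intro y hy
    have h1 := H (g + ContinuousMap.const K (y - g t)) (by
      rw [dist_eq_norm, add_sub_cancel_left, ContinuousMap.norm_lt_iff _ hδ]
      intro s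
      simpa [dist_eq_norm] using hy)
    have h2 := (ContinuousMap.dist_apply_le_dist (f := f'.comp (g + ContinuousMap.const K (y - g t)))
      (g := f'.comp g) t).trans h1.le
    simpa [dist_eq_norm] using h2
  have hg₁t : g₁ t ∈ Metric.ball (g t) δ :=
    lt_of_le_of_lt (ContinuousMap.dist_apply_le_dist t) hg₁
  have h3 := (convex_ball (g t) δ).norm_image_sub_le_of_norm_hasFDerivWithin_le'
    (fun y _ => (hf y).hasFDerivWithinAt) hball (Metric.mem_ball_self hδ) hg₁t
  refine h3.trans ?_
  gcongr
  exact (g₁ - g).norm_coe_le_norm t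

/-- The derivative is again a postcomposition, with `fderiv ℝ f`, followed by a bounded linear map.
The induction changes the codomain to `E →L[ℝ] F`, hence the quantifier over `F` and the common
universe. -/
theorem contDiff_nat_postcomp (n : ℕ) : ∀ {F : Type u} [NormedAddCommGroup F] [NormedSpace ℝ F]
    (f : C(E, F)), ContDiff ℝ ∞ f → ContDiff ℝ n (fun g : C(K, E) => f.comp g) := by
  induction n with
  | zero =>
    intro F _ _ f _
    exact contDiff_zero.2 (ContinuousMap.continuous_postcomp f)
  | succ n ih =>
    intro F _ _ f hf
    have hf' : ContDiff ℝ ∞ (fderiv ℝ f) := hf.fderiv_right (by simp)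
    let f' : C(E, E →L[ℝ] F) := ⟨fderiv ℝ f, hf'.continuous⟩
    have hD : ContDiff ℝ n (fun g : C(K, E) => pointwiseApply K E F (f'.comp g)) :=
      ContDiff.comp (g := pointwiseApply K E F) (by fun_prop) (ih f' hf')
    refine contDiff_succ_iff_hasFDerivAt.2
      ⟨fun g => pointwiseApply K E F (f'.comp g), hD, fun g => ?_⟩
    exact hasFDerivAt_postcomp (f' := f')
      (fun x => (hf.differentiable (by simp) x).hasFDerivAt) g

/-- Post-composition with a smooth map is a smooth map between spaces of continuous functions
on a compact space. -/
theorem contDiff_postcomp (f : C(E, F)) (hf : ContDiff ℝ ∞ f) :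
    ContDiff ℝ ∞ (fun g : C(K, E) => f.comp g) :=
  contDiff_infty.2 fun n => contDiff_nat_postcomp n f hf

end Postcomposition

/-! ### Smooth inverse function theorem -/

section InverseFunction

variable {E F : Type*} [NormedAddCommGroup E] [NormedSpace ℝ E] [CompleteSpace E]
  [NormedAddCommGroup F] [NormedSpace ℝ F]

/-- The inverse function theorem for smooth maps, with smoothness on a full neighbourhood. -/
theorem exists_openPartialHomeomorph_contDiffOn {f : E → F} {s : Set E} (hs : IsOpen s)
    (hf : ContDiffOn ℝ ∞ f s) {a : E} (ha : a ∈ s) {f' : E ≃L[ℝ] F}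
    (hf' : HasFDerivAt f (f' : E →L[ℝ] F) a) :
    ∃ e : OpenPartialHomeomorph E F, a ∈ e.source ∧ e.source ⊆ s ∧ (e : E → F) = f ∧
      ContDiffOn ℝ ∞ e.symm e.target ∧ ∀ x ∈ e.source, (fderiv ℝ f x).IsInvertible := by
  have hfa : ContDiffAt ℝ ∞ f a := hf.contDiffAt (hs.mem_nhds ha)
  let e₀ := hfa.toOpenPartialHomeomorph f hf' (by simp)
  have he₀ : (e₀ : E → F) = f := rfl
  -- The source is cut down to the open set where the derivative is invertible, so that the inverse
  -- is smooth on its whole domain.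
  have hopen : IsOpen (s ∩ fderiv ℝ f ⁻¹' Set.range ((↑) : (E ≃L[ℝ] F) → E →L[ℝ] F)) :=
    (hf.continuousOn_fderiv_of_isOpen hs (by simp)).isOpen_inter_preimage hs
      ContinuousLinearEquiv.isOpen
  let e := e₀.restrOpen _ hopen
  have hsrc : e.source = e₀.source ∩
    (s ∩ fderiv ℝ f ⁻¹' Set.range ((↑) : (E ≃L[ℝ] F) → E →L[ℝ] F)) := rfl
  refine ⟨e, ?_, ?_, rfl, ?_, ?_⟩
  · exact ⟨hfa.mem_toOpenPartialHomeomorph_source hf' (by simp), ha, f', hf'.fderiv.symm⟩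
  · exact fun x hx => hx.2.1
  · intro y hy
    obtain ⟨hx₀, hxs, B, hB⟩ := e.map_target hy
    have hfx : ContDiffAt ℝ ∞ f (e.symm y) := hf.contDiffAt (hs.mem_nhds hxs)
    refine (e.contDiffAt_symm hy (f₀' := B) ?_ hfx).contDiffWithinAt
    rw [hB]
    exact (hfx.differentiableAt (by simp)).hasFDerivAt
  · rintro x ⟨-, -, B, hB⟩
    exact ⟨B, hB⟩

/-- The inverse function theorem for maps `(x, z) ↦ (x, f (x, z))` such that the partial
derivative of `f` in the second variable is the identity at the base point. -/
theorem exists_openPartialHomeomorph_prodMk [CompleteSpace F] {f : E × F → F} {s : Set (E × F)}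
    (hs : IsOpen s) (hf : ContDiffOn ℝ ∞ f s) {x₀ : E} {z₀ : F} (h₀ : (x₀, z₀) ∈ s)
    (hid : HasFDerivAt (fun z => f (x₀, z)) (ContinuousLinearMap.id ℝ F) z₀) :
    ∃ e : OpenPartialHomeomorph (E × F) (E × F), (x₀, z₀) ∈ e.source ∧ e.source ⊆ s ∧
      (e : E × F → E × F) = (fun p => (p.1, f p)) ∧ ContDiffOn ℝ ∞ e.symm e.target ∧
      ∀ p ∈ e.source, (fderiv ℝ (fun p : E × F => (p.1, f p)) p).IsInvertible := by
  have hfd : HasFDerivAt f (fderiv ℝ f (x₀, z₀)) (x₀, z₀) :=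
    ((hf.contDiffAt (hs.mem_nhds h₀)).differentiableAt (by simp)).hasFDerivAt
  have hinr : (fderiv ℝ f (x₀, z₀)).comp (ContinuousLinearMap.inr ℝ E F) =
      ContinuousLinearMap.id ℝ F :=
    (hfd.comp z₀ (hasFDerivAt_prodMk_right x₀ z₀)).unique hid
  -- The derivative at the base point is block triangular with identities on the diagonal.
  refine exists_openPartialHomeomorph_contDiffOn hs (contDiffOn_fst.prodMk hf) h₀
    (f' := (ContinuousLinearEquiv.refl ℝ E).skewProd (ContinuousLinearEquiv.refl ℝ F)
      ((fderiv ℝ f (x₀, z₀)).comp (ContinuousLinearMap.inl ℝ E F))) ?_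
  convert! hasFDerivAt_fst.prodMk hfd using 1
  refine ContinuousLinearMap.ext fun p => Prod.ext (by simp) ?_
  have h1 : fderiv ℝ f (x₀, z₀) (0, p.2) = p.2 := DFunLike.congr_fun hinr p.2
  have h2 : p = (p.1, 0) + (0, p.2) := by simp
  conv_rhs => rw [h2]
  simp [map_add, h1, add_comm, -Prod.mk_add_mk]

end InverseFunction

/-! ### Solving `dy = a dx` along rays -/

section TotalDifferentialEquation

open scoped unitInterval

variable {E₁ E₂ : Type u} [NormedAddCommGroup E₁] [NormedSpace ℝ E₁]
  [NormedAddCommGroup E₂] [NormedSpace ℝ E₂]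

/-- The primitive `t ↦ ∫₀ᵗ g` of a curve on the unit interval, extended to the real line. -/
noncomputable def primitive (g : C(I, E₂)) (t : ℝ) : E₂ :=
  ∫ s in (0 : ℝ)..t, Set.IccExtend zero_le_one g s

theorem continuous_IccExtend {X : Type*} [TopologicalSpace X] (g : C(I, X)) :
    Continuous (Set.IccExtend (zero_le_one : (0 : ℝ) ≤ 1) g) :=
  g.continuous.Icc_extend'

/-- Extending `g` by constants beyond the interval gives two-sided derivatives at `0` and `1` too.
-/
theorem hasDerivAt_primitive [CompleteSpace E₂] (g : C(I, E₂)) (t : ℝ) :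
    HasDerivAt (primitive g) (Set.IccExtend zero_le_one g t) t :=
  ((continuous_IccExtend g).integral_hasStrictDerivAt 0 t).hasDerivAt

/-- The operator sending a curve on the unit interval to its primitive vanishing at `0`. -/
noncomputable def primitiveCLM (E₂ : Type*) [NormedAddCommGroup E₂] [NormedSpace ℝ E₂]
    [CompleteSpace E₂] : C(I, E₂) →L[ℝ] C(I, E₂) :=
  LinearMap.mkContinuous
    { toFun := fun g => ⟨fun t => primitive g t,
        (continuous_iff_continuousAt.2 fun t => (hasDerivAt_primitive g t).continuousAt).comp
          continuous_subtype_val⟩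
      map_add' := fun g g' => by
        ext t
        exact intervalIntegral.integral_add ((continuous_IccExtend g).intervalIntegrable _ _)
          ((continuous_IccExtend g').intervalIntegrable _ _)
      map_smul' := fun c g => by
        ext t
        exact intervalIntegral.integral_smul c _ }
    1 (fun g => by
      rw [ContinuousMap.norm_le _ (by positivity)]
      intro t
      refine (intervalIntegral.norm_integral_le_of_norm_le_const (C := ‖g‖)
        fun s _ => g.norm_coe_le_norm _).trans ?_
      rw [mul_comm]
      gcongr
      rw [sub_zero, abs_of_nonneg t.2.1]
      exact t.2.2)

@[simp] theorem primitiveCLM_apply [CompleteSpace E₂] (g : C(I, E₂)) (t : I) :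
    primitiveCLM E₂ g t = primitive g t := rfl

/-- The curve `s ↦ (s x, x, γ s)`, as a function of `((x, y), γ)`. -/
noncomputable def rayLift (E₁ E₂ : Type*) [NormedAddCommGroup E₁] [NormedSpace ℝ E₁]
    [NormedAddCommGroup E₂] [NormedSpace ℝ E₂] :
    ((E₁ × E₂) × C(I, E₂)) →L[ℝ] C(I, E₁ × E₁ × E₂) :=
  LinearMap.mkContinuous
    { toFun := fun p => ⟨fun s => ((s : ℝ) • p.1.1, p.1.1, p.2 s), by fun_prop⟩
      map_add' := fun p p' => by ext s <;> simp
      map_smul' := fun c p => ContinuousMap.ext fun s => Prod.ext (smul_comm _ _ _) rfl }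
    1 (fun p => by
      rw [ContinuousMap.norm_le _ (by positivity), one_mul]
      intro s
      have h1 : ‖p.1.1‖ ≤ ‖p‖ := (norm_fst_le p.1).trans (norm_fst_le p)
      have h2 : ‖p.2 s‖ ≤ ‖p‖ := (p.2.norm_coe_le_norm s).trans (norm_snd_le p)
      have h3 : ‖(s : ℝ) • p.1.1‖ ≤ ‖p‖ := by
        rw [norm_smul, Real.norm_of_nonneg s.2.1]
        exact (mul_le_of_le_one_left (norm_nonneg _) s.2.2).trans h1
      exact norm_prod_le_iff.2 ⟨h3, norm_prod_le_iff.2 ⟨h1, h2⟩⟩)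

@[simp] theorem rayLift_apply (p : (E₁ × E₂) × C(I, E₂)) (s : I) :
    rayLift E₁ E₂ p s = ((s : ℝ) • p.1.1, p.1.1, p.2 s) := rfl

/-- The right-hand side `(u, x, y) ↦ a (u, y) x` of the total differential equation `dy = a dx`
restricted to rays. -/
noncomputable def rayRHS (a : C(E₁ × E₂, E₁ →L[ℝ] E₂)) : C(E₁ × E₁ × E₂, E₂) :=
  ⟨fun p => a (p.1, p.2.2) p.2.1, by fun_prop⟩

theorem contDiff_rayRHS {a : C(E₁ × E₂, E₁ →L[ℝ] E₂)} (ha : ContDiff ℝ ∞ a) :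
    ContDiff ℝ ∞ (rayRHS a) :=
  (ha.comp (contDiff_fst.prodMk contDiff_snd.snd)).clm_apply contDiff_snd.fst

variable [CompleteSpace E₂]

/-- The integral equation for the solution along rays of `dy = a dx`. -/
noncomputable def rayEquation (a : C(E₁ × E₂, E₁ →L[ℝ] E₂)) (p : (E₁ × E₂) × C(I, E₂)) :
    C(I, E₂) :=
  p.2 - ContinuousLinearMap.const ℝ I p.1.2
    - primitiveCLM E₂ ((rayRHS a).comp (rayLift E₁ E₂ p))

theorem contDiff_rayEquation {a : C(E₁ × E₂, E₁ →L[ℝ] E₂)} (ha : ContDiff ℝ ∞ a) :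
    ContDiff ℝ ∞ (rayEquation a) := by
  have h1 : ContDiff ℝ ∞ (fun p : (E₁ × E₂) × C(I, E₂) =>
      (rayRHS a).comp (rayLift E₁ E₂ p)) :=
    (contDiff_postcomp (rayRHS a) (contDiff_rayRHS ha)).comp (rayLift E₁ E₂).contDiff
  have h2 : ContDiff ℝ ∞ (fun p : (E₁ × E₂) × C(I, E₂) =>
      ContinuousLinearMap.const ℝ I p.1.2) := by
    exact (ContinuousLinearMap.const ℝ I : E₂ →L[ℝ] C(I, E₂)).contDiff.comp contDiff_fst.snd
  exact (contDiff_snd.sub h2).sub ((primitiveCLM E₂).contDiff.comp h1)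

theorem rayEquation_zero_fst (a : C(E₁ × E₂, E₁ →L[ℝ] E₂)) (y : E₂) (g : C(I, E₂)) :
    rayEquation a ((0, y), g) = g - ContinuousLinearMap.const ℝ I y := by
  have h : (rayRHS a).comp (rayLift E₁ E₂ ((0, y), g)) = 0 := by
    ext s; simp [rayRHS]
  rw [rayEquation, h, map_zero, sub_zero]

/-- Smooth dependence on the data of the solution along rays. -/
theorem exists_contDiffOn_rayEquation_eq_zero [CompleteSpace E₁]
    {a : C(E₁ × E₂, E₁ →L[ℝ] E₂)} (ha : ContDiff ℝ ∞ a) :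
    ∃ (V : Set (E₁ × E₂)) (Y : E₁ × E₂ → C(I, E₂)), IsOpen V ∧ (0, 0) ∈ V ∧
      ContDiffOn ℝ ∞ Y V ∧ Y (0, 0) = 0 ∧ ∀ q ∈ V, rayEquation a (q, Y q) = 0 := by
  -- At `x = 0` the integral term vanishes and the equation is affine in the curve, with linear part
  -- the identity. The solution is then the slice `(q, 0)` of the local inverse of `(q, γ) ↦ (q,
  -- rayEquation a (q, γ))`.
  have hid : HasFDerivAt (fun g => rayEquation a (((0 : E₁), (0 : E₂)), g))
      (ContinuousLinearMap.id ℝ C(I, E₂)) 0 := by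
    simp only [rayEquation_zero_fst, map_zero, sub_zero]
    exact hasFDerivAt_id _
  obtain ⟨e, he0, -, hecoe, hesymm, -⟩ := exists_openPartialHomeomorph_prodMk isOpen_univ
    (contDiff_rayEquation ha).contDiffOn (Set.mem_univ _) hid
  have hcoe : ∀ p, e p = (p.1, rayEquation a p) := fun p => by rw [hecoe]
  have hbase : e (((0 : E₁), (0 : E₂)), 0) = ((0, 0), 0) := by
    rw [hcoe, rayEquation_zero_fst]; simp
  have hsymm : ∀ q : E₁ × E₂, (q, (0 : C(I, E₂))) ∈ e.target →
      (e.symm (q, 0)).1 = q ∧ rayEquation a (e.symm (q, 0)) = 0 := by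
    intro q hq
    have := e.right_inv hq
    rw [hcoe] at this
    exact ⟨congrArg Prod.fst this, congrArg Prod.snd this⟩
  have hc : Continuous fun q : E₁ × E₂ => (q, (0 : C(I, E₂))) := by fun_prop
  refine ⟨(fun q => (q, 0)) ⁻¹' e.target, fun q => (e.symm (q, 0)).2,
    e.open_target.preimage hc, ?_, ?_, ?_, ?_⟩
  · have := e.map_source he0
    rwa [hbase] at this
  · refine contDiffOn_snd.comp (hesymm.comp ?_ fun q hq => hq) (fun q _ => Set.mem_univ _)
    exact (contDiff_id.prodMk contDiff_const).contDiffOn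
  · have := e.left_inv he0
    rw [hbase] at this
    simp [this]
  · intro q hq
    obtain ⟨h1, h2⟩ := hsymm q hq
    have : (q, (e.symm (q, 0)).2) = e.symm (q, 0) := Prod.ext h1.symm rfl
    simpa only [this] using h2

end TotalDifferentialEquation

/-! ### Frobenius' theorem for graphs -/

section FrobeniusGraph

open scoped unitInterval

variable {E₁ E₂ : Type u} [NormedAddCommGroup E₁] [NormedSpace ℝ E₁]
  [NormedAddCommGroup E₂] [NormedSpace ℝ E₂]

/-- The integrability condition for the total differential equation `dy = a(x, y) dx` on `W`. -/
def TotallyIntegrableOn (a : E₁ × E₂ → E₁ →L[ℝ] E₂) (W : Set (E₁ × E₂)) : Prop :=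
  ∀ p ∈ W, ∀ v w : E₁, fderiv ℝ a p (v, a p v) w = fderiv ℝ a p (w, a p w) v

theorem fderiv_rayRHS_apply {a : C(E₁ × E₂, E₁ →L[ℝ] E₂)} (ha : ContDiff ℝ ∞ a)
    (p q : E₁ × E₁ × E₂) :
    fderiv ℝ (rayRHS a) p q =
      fderiv ℝ a (p.1, p.2.2) (q.1, q.2.2) p.2.1 + a (p.1, p.2.2) q.2.1 := by
  have h1 : HasFDerivAt (fun p : E₁ × E₁ × E₂ => (p.1, p.2.2))
      ((ContinuousLinearMap.fst ℝ E₁ (E₁ × E₂)).prod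
        ((ContinuousLinearMap.snd ℝ E₁ E₂).comp (ContinuousLinearMap.snd ℝ E₁ (E₁ × E₂)))) p :=
    hasFDerivAt_fst.prodMk hasFDerivAt_snd.snd
  have h2 : HasFDerivAt a (fderiv ℝ a (p.1, p.2.2)) (p.1, p.2.2) :=
    (ha.differentiable (by simp) _).hasFDerivAt
  have h3 := (h2.comp p h1).clm_apply (hasFDerivAt_snd (p := p)).fst
  have h4 : fderiv ℝ (rayRHS a) p = _ := h3.fderiv
  rw [h4]
  simp [add_comm]

/-- The variation of a solution of `dy = a dx` along the ray through `x` in the direction `v`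
agrees with `a v` at the end of the ray. -/
theorem variation_eq_of_totallyIntegrableOn {a : E₁ × E₂ → E₁ →L[ℝ] E₂} (ha : ContDiff ℝ ∞ a)
    {W : Set (E₁ × E₂)} (hint : TotallyIntegrableOn a W) (x v : E₁) {Z Z' P P' : ℝ → E₂}
    (hZ : ∀ t, HasDerivAt Z (Z' t) t) (hP : ∀ t, HasDerivAt P (P' t) t) (hP0 : P 0 = 0)
    (hZ' : ∀ t ∈ Set.Icc (0 : ℝ) 1, Z' t = a (t • x, Z t) x)
    (hP' : ∀ t ∈ Set.Icc (0 : ℝ) 1,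
      P' t = fderiv ℝ a (t • x, Z t) (t • v, P t) x + a (t • x, Z t) v)
    (hW : ∀ t ∈ Set.Icc (0 : ℝ) 1, (t • x, Z t) ∈ W) :
    P 1 = a (x, Z 1) v := by
  -- The defect `w(t) = P t - t • a (t • x, Z t) v` vanishes at `0` and will satisfy a homogeneous
  -- linear equation, so Grönwall forces `w = 0` on the unit interval.
  have hw' : ∀ t, HasDerivAt (fun t => P t - t • a (t • x, Z t) v) (P' t -
      (t • fderiv ℝ a (t • x, Z t) (x, Z' t) v + a (t • x, Z t) v)) t := by
    intro t
    have h1 : HasDerivAt (fun t => (t • x, Z t)) (x, Z' t) t := by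
      simpa using ((hasDerivAt_id t).smul_const x).prodMk (hZ t)
    have h2 : HasFDerivAt a (fderiv ℝ a (t • x, Z t)) (t • x, Z t) :=
      (ha.differentiable (by simp) _).hasFDerivAt
    have h2' : HasDerivAt (fun t => a (t • x, Z t)) (fderiv ℝ a (t • x, Z t) (x, Z' t)) t :=
      HasFDerivAt.comp_hasDerivAt (l := a) (f := fun t => (t • x, Z t)) t h2 h1
    have h3 : HasDerivAt (fun t => a (t • x, Z t) v) (fderiv ℝ a (t • x, Z t) (x, Z' t) v) t :=
      ((ContinuousLinearMap.apply ℝ E₂ v).hasFDerivAt).comp_hasDerivAt t h2'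
    have h4 : HasDerivAt (fun t => P t - t • a (t • x, Z t) v) (P' t -
        (t • fderiv ℝ a (t • x, Z t) (x, Z' t) v + (1 : ℝ) • a (t • x, Z t) v)) t :=
      (hP t).sub ((hasDerivAt_id t).smul h3)
    rwa [one_smul] at h4
  have hcont : Continuous fun t : ℝ => fderiv ℝ a (t • x, Z t) := by
    have h1 : Continuous Z := continuous_iff_continuousAt.2 fun t => (hZ t).continuousAt
    exact (ha.fderiv_right (m := ∞) (by simp)).continuous.comp (by fun_prop)
  obtain ⟨C, hC⟩ := (isCompact_Icc (a := (0 : ℝ)) (b := 1)).exists_bound_of_continuousOn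
    (E := E₁ × E₂ →L[ℝ] E₁ →L[ℝ] E₂) hcont.continuousOn
  have hw0 : ∀ t ∈ Set.Icc (0 : ℝ) 1, P t - t • a (t • x, Z t) v = 0 := by
    refine eq_zero_of_abs_deriv_le_mul_abs_self_of_eq_zero_right (K := C * ‖x‖)
      (fun t _ => (hw' t).continuousAt.continuousWithinAt)
      (fun t _ => (hw' t).hasDerivWithinAt) (by simp [hP0]) fun t ht => ?_
    have htI : t ∈ Set.Icc (0 : ℝ) 1 := ⟨ht.1, ht.2.le⟩
    -- Integrability exchanges `x` and `v`; both remaining derivatives are then applied to `x`, and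
    -- their directions differ only by `w` in the second factor.
    have key : P' t - (t • fderiv ℝ a (t • x, Z t) (x, Z' t) v + a (t • x, Z t) v) =
        fderiv ℝ a (t • x, Z t) (0, P t - t • a (t • x, Z t) v) x := by
      rw [hP' t htI, hZ' t htI, hint _ (hW t htI) x v]
      have h1 : ((0 : E₁), P t - t • a (t • x, Z t) v) =
          (t • v, P t) - t • (v, a (t • x, Z t) v) := by simp
      rw [h1, map_sub, map_smul, sub_apply, smul_apply]
      abel
    rw [key]
    calc ‖fderiv ℝ a (t • x, Z t) (0, P t - t • a (t • x, Z t) v) x‖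
        ≤ ‖fderiv ℝ a (t • x, Z t)‖ * ‖((0 : E₁), P t - t • a (t • x, Z t) v)‖ * ‖x‖ :=
          ContinuousLinearMap.le_opNorm₂ _ _ _
      _ ≤ C * ‖P t - t • a (t • x, Z t) v‖ * ‖x‖ := by
          have : ‖((0 : E₁), P t - t • a (t • x, Z t) v)‖ = ‖P t - t • a (t • x, Z t) v‖ := by
            simp [Prod.norm_def]
          rw [this]
          gcongr
          exact hC t htI
      _ = C * ‖x‖ * ‖P t - t • a (t • x, Z t) v‖ := by ring
  simpa [sub_eq_zero] using hw0 1 (by simp)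

variable [CompleteSpace E₂]

/-- The integral equation for the derivative of a family of solutions along rays. -/
theorem fderiv_solution_eq_primitive {a : C(E₁ × E₂, E₁ →L[ℝ] E₂)} (ha : ContDiff ℝ ∞ a)
    {Y : E₁ × E₂ → C(I, E₂)} {q : E₁ × E₂} (hY : DifferentiableAt ℝ Y q)
    (hq : ∀ᶠ q' in 𝓝 q, rayEquation a (q', Y q') = 0) (v : E₁) :
    ∃ g : C(I, E₂), fderiv ℝ Y q (v, 0) = primitiveCLM E₂ g ∧ ∀ t : I, g t =
      fderiv ℝ a ((t : ℝ) • q.1, Y q t) ((t : ℝ) • v, fderiv ℝ Y q (v, 0) t) q.1 +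
        a ((t : ℝ) • q.1, Y q t) v := by
  have hf : ContDiff ℝ ∞ (rayRHS a) := contDiff_rayRHS ha
  let f' : C(E₁ × E₁ × E₂, (E₁ × E₁ × E₂) →L[ℝ] E₂) :=
    ⟨fderiv ℝ (rayRHS a), (hf.fderiv_right (m := ∞) (by simp)).continuous⟩
  let A := pointwiseApply I _ E₂ (f'.comp (rayLift E₁ E₂ (q, Y q)))
  refine ⟨A (rayLift E₁ E₂ ((v, 0), fderiv ℝ Y q (v, 0))), ?_,
    fun t => fderiv_rayRHS_apply ha _ _⟩
  have h1 : HasFDerivAt Y (fderiv ℝ Y q) q := hY.hasFDerivAt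
  have h2 : HasFDerivAt (fun q => rayLift E₁ E₂ (q, Y q)) ((rayLift E₁ E₂).comp
      ((ContinuousLinearMap.id ℝ (E₁ × E₂)).prod (fderiv ℝ Y q))) q :=
    (rayLift E₁ E₂).hasFDerivAt.comp q ((hasFDerivAt_id _).prodMk h1)
  have h3' : HasFDerivAt (fun c : C(I, E₁ × E₁ × E₂) => (rayRHS a).comp c) A
      (rayLift E₁ E₂ (q, Y q)) :=
    hasFDerivAt_postcomp (f := rayRHS a) (f' := f')
      (fun p => (hf.differentiable (by simp) p).hasFDerivAt) _
  have h3 := HasFDerivAt.comp q h3' h2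
  have h4 : HasFDerivAt (fun q : E₁ × E₂ =>
      (ContinuousLinearMap.const ℝ I : E₂ →L[ℝ] C(I, E₂)) q.2) _ q :=
    (ContinuousLinearMap.const ℝ I : E₂ →L[ℝ] C(I, E₂)).hasFDerivAt.comp q hasFDerivAt_snd
  -- The chain rule derivative must agree with `0`, since the equation holds near `q`. In the
  -- direction `(v, 0)` the initial value does not vary.
  have h5 : HasFDerivAt (fun q => rayEquation a (q, Y q)) _ q :=
    (h1.sub h4).sub ((primitiveCLM E₂).hasFDerivAt.comp q h3)
  have h6 : HasFDerivAt (fun q => rayEquation a (q, Y q)) (0 : E₁ × E₂ →L[ℝ] C(I, E₂)) q :=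
    (hasFDerivAt_const (0 : C(I, E₂)) q).congr_of_eventuallyEq hq
  have h7 := DFunLike.congr_fun (h5.unique h6) (v, 0)
  have h8 : fderiv ℝ Y q (v, 0) - ContinuousLinearMap.const ℝ I (0 : E₂) -
    primitiveCLM E₂ (A (rayLift E₁ E₂ ((v, 0), fderiv ℝ Y q (v, 0)))) = 0 := h7
  rwa [map_zero, sub_zero, sub_eq_zero] at h8

/-- Solving along rays solves the total differential equation, if the latter is integrable. -/
theorem fderiv_solution_apply {a : C(E₁ × E₂, E₁ →L[ℝ] E₂)} (ha : ContDiff ℝ ∞ a)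
    {W : Set (E₁ × E₂)} (hint : TotallyIntegrableOn a W)
    {Y : E₁ × E₂ → C(I, E₂)} {q : E₁ × E₂} (hY : DifferentiableAt ℝ Y q)
    (hq : ∀ᶠ q' in 𝓝 q, rayEquation a (q', Y q') = 0)
    (hW : ∀ s : I, ((s : ℝ) • q.1, Y q s) ∈ W) (v : E₁) :
    fderiv ℝ Y q (v, 0) 1 = a (q.1, Y q 1) v := by
  obtain ⟨g, hηg, hg⟩ := fderiv_solution_eq_primitive ha hY hq v
  let k : C(I, E₂) := (rayRHS a).comp (rayLift E₁ E₂ (q, Y q))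
  have hYk : Y q = ContinuousLinearMap.const ℝ I q.2 + primitiveCLM E₂ k := by
    have := hq.self_of_nhds
    rw [rayEquation, sub_sub, sub_eq_zero] at this
    exact this
  have hZ : ∀ t : I, q.2 + primitive k t = Y q t := fun t => by
    conv_rhs => rw [hYk]
    rfl
  have hη : ∀ t : I, primitive g t = fderiv ℝ Y q (v, 0) t := fun t => by rw [hηg]; rfl
  have h1 := variation_eq_of_totallyIntegrableOn ha hint q.1 v
    (fun t => (hasDerivAt_primitive k t).const_add q.2) (hasDerivAt_primitive g)
    (by simp [primitive])
    (fun t ht => by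
      rw [Set.IccExtend_of_mem _ _ ht, hZ ⟨t, ht⟩]
      rfl)
    (fun t ht => by
      rw [Set.IccExtend_of_mem _ _ ht, hZ ⟨t, ht⟩, hη ⟨t, ht⟩]
      exact hg ⟨t, ht⟩)
    (fun t ht => by
      rw [hZ ⟨t, ht⟩]
      exact hW ⟨t, ht⟩)
  have h2 := hη 1
  have h3 := hZ 1
  rw [Set.Icc.coe_one] at h2 h3
  rw [← h2, h1, h3]

/-- Frobenius' theorem for a distribution given as the graph of a smooth, globally defined
`a : E₁ × E₂ → E₁ →L[ℝ] E₂`. -/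
theorem exists_flat_openPartialHomeomorph_of_graph [CompleteSpace E₁]
    {a : E₁ × E₂ → E₁ →L[ℝ] E₂} (ha : ContDiff ℝ ∞ a)
    {W : Set (E₁ × E₂)} (hWo : IsOpen W) (hW0 : (0, 0) ∈ W) (hint : TotallyIntegrableOn a W) :
    ∃ e : OpenPartialHomeomorph (E₁ × E₂) (E₁ × E₂), (0, 0) ∈ e.source ∧ e.source ⊆ W ∧
      ContDiffOn ℝ ∞ e e.source ∧ ContDiffOn ℝ ∞ e.symm e.target ∧
      ∀ z ∈ e.source, ∀ u : E₁ × E₂, (fderiv ℝ e z u).2 = 0 ↔ u.2 = a z u.1 := by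
  lift a to C(E₁ × E₂, E₁ →L[ℝ] E₂) using ha.continuous
  obtain ⟨V, Y, hVo, hV0, hYs, hY0, hYeq⟩ := exists_contDiffOn_rayEquation_eq_zero ha
  -- Integrability is only known on `W`, so the whole solution over the ray must stay there. This is
  -- an open condition in the compact-open topology because `I` is compact.
  let S : Set (E₁ × E₂) := V ∩ (fun q => rayLift E₁ E₂ (q, Y q)) ⁻¹'
    {g | Set.MapsTo g Set.univ {p | (p.1, p.2.2) ∈ W}}
  have hSo : IsOpen S := by
    refine ContinuousOn.isOpen_inter_preimage ?_ hVo
      (ContinuousMap.isOpen_setOfPred_mapsTo isCompact_univ (hWo.preimage (by fun_prop)))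
    exact (rayLift E₁ E₂).continuous.comp_continuousOn (continuousOn_id.prodMk hYs.continuousOn)
  have hS0 : ((0 : E₁), (0 : E₂)) ∈ S := by
    refine ⟨hV0, fun s _ => ?_⟩
    simpa [hY0] using hW0
  have hSW : ∀ q ∈ S, ∀ s : I, ((s : ℝ) • q.1, Y q s) ∈ W := fun q hq s => hq.2 (Set.mem_univ s)
  have hYev : ∀ q ∈ V, ∀ᶠ q' in 𝓝 q, rayEquation a (q', Y q') = 0 := fun q hq => by
    filter_upwards [hVo.mem_nhds hq] with q' hq' using hYeq q' hq'
  let φ : E₁ × E₂ → E₂ := fun q => Y q 1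
  let ev : C(I, E₂) →L[ℝ] E₂ := ContinuousMap.evalCLM ℝ 1
  have hφs : ContDiffOn ℝ ∞ φ S := ev.contDiff.comp_contDiffOn (hYs.mono Set.inter_subset_left)
  have hYd : ∀ q ∈ S, DifferentiableAt ℝ Y q := fun q hq =>
    (hYs.contDiffAt (hVo.mem_nhds hq.1)).differentiableAt (by simp)
  have hφd : ∀ q ∈ S, ∀ v, fderiv ℝ φ q (v, 0) = a (q.1, φ q) v := fun q hq v => by
    have h1 : HasFDerivAt φ (ev.comp (fderiv ℝ Y q)) q :=
      ev.hasFDerivAt.comp q (hYd q hq).hasFDerivAt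
    rw [h1.fderiv]
    exact fderiv_solution_apply ha hint (hYd q hq) (hYev q hq.1) (hSW q hq) v
  have hid : HasFDerivAt (fun y => φ ((0 : E₁), y)) (ContinuousLinearMap.id ℝ E₂) 0 := by
    refine (hasFDerivAt_id (𝕜 := ℝ) (0 : E₂)).congr_of_eventuallyEq ?_
    have hc : ContinuousAt (fun y : E₂ => ((0 : E₁), y)) 0 := by fun_prop
    filter_upwards [hc.preimage_mem_nhds (hVo.mem_nhds hV0)] with y hy
    have h1 := hYeq _ hy
    rw [rayEquation_zero_fst, sub_eq_zero] at h1
    simp [φ, h1]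
  obtain ⟨e, he0, heS, hecoe, hesymm, heinv⟩ :=
    exists_openPartialHomeomorph_prodMk hSo hφs hS0 hid
  have hcoe : ∀ p, e p = (p.1, φ p) := fun p => by rw [hecoe]
  have hes : ContDiffOn ℝ ∞ e e.source := by
    rw [hecoe]
    exact (contDiffOn_fst.prodMk hφs).mono heS
  -- `e` carries the slices of constant initial value to integral leaves, so its inverse is the
  -- flattening chart.
  refine ⟨e.symm, ?_, ?_, hesymm, hes, ?_⟩
  · have := e.map_source he0
    rw [hcoe] at this
    simpa [φ, hY0] using this
  · intro z hz
    have h1 := hSW _ (heS (e.map_target hz)) 1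
    have h2 : e (e.symm z) = ((1 : ℝ) • (e.symm z).1, Y (e.symm z) 1) := by
      rw [hcoe, one_smul]
    rw [← e.right_inv hz, h2]
    exact h1
  · intro z hz u
    set q := e.symm z with hq
    have hqs : q ∈ e.source := e.map_target hz
    have hqS : q ∈ S := heS hqs
    have hqz : (q.1, φ q) = z := by rw [← hcoe]; exact e.right_inv hz
    obtain ⟨B, hB⟩ := heinv q hqs
    have hφq : HasFDerivAt φ (fderiv ℝ φ q) q :=
      ((hφs.contDiffAt (hSo.mem_nhds hqS)).differentiableAt (by simp)).hasFDerivAt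
    have hBapp : ∀ p, B p = (p.1, fderiv ℝ φ q p) := fun p => by
      have h1 : (B : E₁ × E₂ →L[ℝ] E₁ × E₂) = _ :=
        hB.trans (hasFDerivAt_fst.prodMk hφq).fderiv
      exact DFunLike.congr_fun h1 p
    have hderiv : HasFDerivAt e.symm (B.symm : E₁ × E₂ →L[ℝ] E₁ × E₂) z := by
      refine e.hasFDerivAt_symm hz ?_
      rw [hecoe, hB]
      exact ((hasFDerivAt_fst.prodMk hφq).differentiableAt).hasFDerivAt
    rw [hderiv.fderiv]
    obtain ⟨p, rfl⟩ := B.surjective u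
    -- The `E₁`-part of the derivative of `φ` is `a`, and its `E₂`-part is injective because `B` is;
    -- hence `B p` lies in the graph of `a z` exactly when `p.2 = 0`.
    have h2 : fderiv ℝ φ q p = a z p.1 + fderiv ℝ φ q (0, p.2) := by
      conv_lhs => rw [show p = (p.1, 0) + (0, p.2) by simp]
      rw [map_add, hφd q hqS, hqz]
    have hBinj : fderiv ℝ φ q (0, p.2) = 0 → p.2 = 0 := fun h => by
      have h3 : B (0, p.2) = B 0 := by rw [hBapp, h, map_zero]; rfl
      exact congrArg Prod.snd (B.injective h3)
    have h4 : (B.symm : E₁ × E₂ →L[ℝ] E₁ × E₂) (B p) = p := B.symm_apply_apply p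
    rw [h4, hBapp]
    simp only [h2, add_eq_left]
    exact ⟨fun h => by rw [h]; exact map_zero _, hBinj⟩

end FrobeniusGraph

/-! ### Frobenius' theorem for kernels of constant dimension -/

section Frobenius

open VectorField

/-- A map that is smooth on an open set agrees near any point of it with a globally smooth map. -/
theorem exists_contDiff_eqOn {X Y : Type*} [NormedAddCommGroup X] [NormedSpace ℝ X]
    [FiniteDimensional ℝ X] [NormedAddCommGroup Y] [NormedSpace ℝ Y] {f : X → Y} {O : Set X}
    (hO : IsOpen O) (hf : ContDiffOn ℝ ∞ f O) {x : X} (hx : x ∈ O) :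
    ∃ (g : X → Y) (W : Set X), ContDiff ℝ ∞ g ∧ IsOpen W ∧ x ∈ W ∧ W ⊆ O ∧ Set.EqOn g f W := by
  obtain ⟨r, hr, hball⟩ := Metric.isOpen_iff.1 hO x hx
  let χ : ContDiffBump x := ⟨r / 4, r / 2, by positivity, by linarith⟩
  refine ⟨fun y => χ y • f y, Metric.ball x (r / 4), ?_, Metric.isOpen_ball,
    Metric.mem_ball_self (by positivity), fun y hy => hball ?_, fun y hy => ?_⟩
  · rw [contDiff_iff_contDiffAt]
    intro y
    by_cases hy : y ∈ O
    · exact χ.contDiff.contDiffAt.smul (hf.contDiffAt (hO.mem_nhds hy))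
    · have hy' : y ∈ (tsupport χ)ᶜ := fun h => by
        rw [χ.tsupport_eq] at h
        refine hy (hball ?_)
        exact Metric.closedBall_subset_ball (by change r / 2 < r; linarith) h
      refine contDiffAt_const (c := (0 : Y)) |>.congr_of_eventuallyEq ?_
      filter_upwards [(isClosed_tsupport χ).isOpen_compl.mem_nhds hy'] with z hz
      rw [image_eq_zero_of_notMem_tsupport hz, zero_smul]
  · exact Metric.ball_subset_ball (by linarith) hy
  · have : χ y = 1 := χ.one_of_mem_closedBall (Metric.ball_subset_closedBall hy)
    simp [this]

variable {E : Type u} [NormedAddCommGroup E] [NormedSpace ℝ E] [FiniteDimensional ℝ E]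

/-- Near any point, the kernels of a smooth family of linear maps of constant nullity are the graphs
of a smooth family of linear maps. -/
theorem exists_ker_eq_graph {W : Type*} [NormedAddCommGroup W] [NormedSpace ℝ W]
    [FiniteDimensional ℝ W] {O : Set E} (hO : IsOpen O) {A : E → E →L[ℝ] W}
    (hA : ContDiffOn ℝ ∞ A O) {k : ℕ} (hk : ∀ z ∈ O, Module.finrank ℝ (A z).ker = k)
    {p : E} (hp : p ∈ O) :
    ∃ (E₁ E₂ : Submodule ℝ E) (ψ : (E₁ × E₂) ≃L[ℝ] E) (a : E → E₁ →L[ℝ] E₂) (O' : Set E),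
      IsOpen O' ∧ p ∈ O' ∧ O' ⊆ O ∧ ContDiffOn ℝ ∞ a O' ∧
      ∀ z ∈ O', ∀ u : E₁ × E₂, A z (ψ u) = 0 ↔ u.2 = a z u.1 := by
  let E₁ : Submodule ℝ E := (A p).ker
  obtain ⟨E₂, hE⟩ := E₁.exists_isCompl
  let ψ : (E₁ × E₂) ≃L[ℝ] E := (E₁.prodEquivOfIsCompl E₂ hE).toContinuousLinearEquiv
  have hψ : ∀ u : E₁ × E₂, ψ u = u.1 + u.2 := fun u => rfl
  -- `A p` is injective on the complement `E₂` of its kernel. Composing with a left inverse makes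
  -- the `E₂`-block the identity at `p`, hence invertible nearby, and `B (A z u) = 0` can be solved
  -- for the `E₂`-component.
  obtain ⟨B₀, hB₀⟩ := LinearMap.exists_leftInverse_of_injective
    ((A p).toLinearMap ∘ₗ E₂.subtype) (by
      rw [LinearMap.ker_eq_bot']
      intro w hw
      have h1 : (w : E) ∈ E₁ ⊓ E₂ := ⟨hw, w.2⟩
      rw [hE.inf_eq_bot] at h1
      exact Subtype.ext h1)
  let B : W →L[ℝ] E₂ := LinearMap.toContinuousLinearMap B₀
  let M : E → E₂ →L[ℝ] E₂ := fun z => B.comp ((A z).comp E₂.subtypeL)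
  let N : E → E₁ →L[ℝ] E₂ := fun z => B.comp ((A z).comp E₁.subtypeL)
  have hM : ContDiffOn ℝ ∞ M O := contDiffOn_const.clm_comp (hA.clm_comp contDiffOn_const)
  have hN : ContDiffOn ℝ ∞ N O := contDiffOn_const.clm_comp (hA.clm_comp contDiffOn_const)
  have hMp : M p = ContinuousLinearMap.id ℝ E₂ := by
    ext1 w
    exact DFunLike.congr_fun hB₀ w
  let O' : Set E := O ∩ M ⁻¹' Set.range ((↑) : (E₂ ≃L[ℝ] E₂) → E₂ →L[ℝ] E₂)
  have hMinv : ∀ z ∈ O', (M z).IsInvertible := fun z hz => hz.2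
  refine ⟨E₁, E₂, ψ, fun z => -((M z).inverse.comp (N z)), O',
    hM.continuousOn.isOpen_inter_preimage hO ContinuousLinearEquiv.isOpen,
    ⟨hp, ContinuousLinearEquiv.refl ℝ E₂, hMp.symm⟩, Set.inter_subset_left, ?_, ?_⟩
  · refine ContDiffOn.neg (ContDiffOn.clm_comp ?_ (hN.mono Set.inter_subset_left))
    intro z hz
    exact ((hMinv z hz).contDiffAt_map_inverse).comp_contDiffWithinAt z
      (hM.mono Set.inter_subset_left z hz)
  · intro z hz
    have hBA : ∀ u : E₁ × E₂, B (A z (ψ u)) = N z u.1 + M z u.2 := fun u => by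
      rw [hψ, map_add, map_add]; rfl
    have hker : ∀ u : E₁ × E₂, B (A z (ψ u)) = 0 ↔
        u.2 = (-((M z).inverse.comp (N z))) u.1 := fun u => by
      obtain ⟨m, hm⟩ := hMinv z hz
      rw [hBA, ← hm, ContinuousLinearMap.inverse_equiv, add_comm, add_eq_zero_iff_eq_neg]
      change m u.2 = _ ↔ u.2 = -(m.symm (N z u.1))
      rw [← map_neg m.symm, ContinuousLinearEquiv.eq_symm_apply]
    have hle : (A z).ker ≤ (B.comp (A z)).ker := fun u hu => by
      have hu' : A z u = 0 := hu
      change B (A z u) = 0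
      rw [hu', map_zero]
    -- Constant dimension enters here: the larger kernel is a graph over `E₁`, so its dimension is
    -- at most `dim E₁ = k`, and no kernel is gained by applying `B`.
    have hfin : Module.finrank ℝ (B.comp (A z)).ker ≤ Module.finrank ℝ (A z).ker := by
      rw [hk z hz.1, ← hk p hp]
      refine LinearMap.finrank_le_finrank_of_injective
        (f := (LinearMap.fst ℝ E₁ E₂ ∘ₗ (ψ.symm : E →ₗ[ℝ] E₁ × E₂)) ∘ₗ
          ((B.comp (A z)).ker).subtype) ?_
      rw [injective_iff_map_eq_zero]
      rintro ⟨u, hu⟩ h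
      obtain ⟨q, rfl⟩ := ψ.surjective u
      have h1 : q.1 = 0 := by
        have h2 : (ψ.symm (ψ q)).1 = 0 := h
        rwa [ψ.symm_apply_apply] at h2
      have h3 := (hker q).1 hu
      rw [h1, map_zero] at h3
      have h4 : q = 0 := Prod.ext h1 h3
      subst h4
      exact Subtype.ext (map_zero ψ)
    have heq := Submodule.eq_of_le_of_finrank_le hle hfin
    intro u
    rw [← hker u]
    exact (SetLike.ext_iff.1 heq (ψ u))

/-- Frobenius' theorem on an open subset of a finite-dimensional vector space, for the
distribution of kernels of a smooth family of linear maps. -/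
theorem exists_flat_openPartialHomeomorph {W : Type*} [NormedAddCommGroup W] [NormedSpace ℝ W]
    [FiniteDimensional ℝ W] {O : Set E} (hO : IsOpen O) {A : E → E →L[ℝ] W}
    (hA : ContDiffOn ℝ ∞ A O) {k : ℕ} (hk : ∀ z ∈ O, Module.finrank ℝ (A z).ker = k)
    (hinv : ∀ O' ⊆ O, IsOpen O' → ∀ X Y : E → E, ContDiffOn ℝ ∞ X O' → ContDiffOn ℝ ∞ Y O' →
      (∀ z ∈ O', A z (X z) = 0) → (∀ z ∈ O', A z (Y z) = 0) →
      ∀ z ∈ O', A z (lieBracket ℝ X Y z) = 0)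
    {p : E} (hp : p ∈ O) :
    ∃ e : OpenPartialHomeomorph E E, p ∈ e.source ∧ e.source ⊆ O ∧
      ContDiffOn ℝ ∞ e e.source ∧ ContDiffOn ℝ ∞ e.symm e.target ∧
      ∃ S : Submodule ℝ E, ∀ z ∈ e.source, ∀ u, A z u = 0 ↔ fderiv ℝ e z u ∈ S := by
  obtain ⟨E₁, E₂, ψ, a, O₁, hO₁, hp₁, hO₁O, ha, hgraph⟩ := exists_ker_eq_graph hO hA hk hp
  -- the involutivity of the distribution, in terms of `a`
  have hsymm : ∀ z ∈ O₁, ∀ v w : E₁,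
      fderiv ℝ a z (ψ (v, a z v)) w = fderiv ℝ a z (ψ (w, a z w)) v := by
    intro z hz v w
    have hX : ∀ v : E₁, ContDiffOn ℝ ∞ (fun z => ψ (v, a z v)) O₁ := fun v =>
      ψ.contDiff.comp_contDiffOn (contDiffOn_const.prodMk (ha.clm_apply contDiffOn_const))
    have hD : ∀ v : E₁, ∀ u, fderiv ℝ (fun z => ψ (v, a z v)) z u =
        ψ (0, fderiv ℝ a z u v) := fun v u => by
      have h1 : HasFDerivAt a (fderiv ℝ a z) z :=
        ((ha.contDiffAt (hO₁.mem_nhds hz)).differentiableAt (by simp)).hasFDerivAt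
      have h2 : HasFDerivAt (fun z => a z v) ((ContinuousLinearMap.apply ℝ E₂ v).comp
          (fderiv ℝ a z)) z :=
        (ContinuousLinearMap.apply ℝ E₂ v).hasFDerivAt.comp z h1
      have h3 := ψ.hasFDerivAt.comp z ((hasFDerivAt_const v z).prodMk h2)
      have h4 : fderiv ℝ (fun z => ψ (v, a z v)) z = _ := h3.fderiv
      rw [h4]
      rfl
    -- The lifts of `v` and `w` have constant `E₁`-components, so their bracket has none; lying in
    -- the graph, it must vanish, which is the asserted symmetry.
    have h1 := hinv O₁ hO₁O hO₁ _ _ (hX v) (hX w) (fun y hy => (hgraph y hy _).2 rfl)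
      (fun y hy => (hgraph y hy _).2 rfl) z hz
    rw [lieBracket_eq] at h1
    simp only [hD, ← map_sub] at h1
    have h2 := (hgraph z hz _).1 h1
    simpa [sub_eq_zero] using h2
  -- centre the coordinates at `p` and extend `a` globally
  let T : E ≃ₜ E₁ × E₂ := (Homeomorph.addRight (-p)).trans ψ.symm.toHomeomorph
  have hTapp : ∀ z, T z = ψ.symm (z + -p) := fun z => rfl
  have hTsymm : ∀ q, T.symm q = ψ q + p := fun q => by
    rw [Homeomorph.symm_apply_eq, hTapp]; simp
  have hTderiv : ∀ z, HasFDerivAt T (ψ.symm : E →L[ℝ] E₁ × E₂) z := fun z =>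
    ψ.symm.hasFDerivAt.comp z ((hasFDerivAt_id z).add_const (-p))
  have hTs : ContDiff ℝ ∞ T := ψ.symm.contDiff.comp (contDiff_id.add contDiff_const)
  have hTss : ContDiff ℝ ∞ T.symm := by
    rw [show (T.symm : E₁ × E₂ → E) = fun q => ψ q + p from funext hTsymm]
    exact ψ.contDiff.add contDiff_const
  have hTp : T p = (0, 0) := by rw [hTapp, add_neg_cancel, map_zero]; rfl
  have hO₂ : IsOpen (T.symm ⁻¹' O₁) := hO₁.preimage T.symm.continuous
  have hb : ContDiffOn ℝ ∞ (a ∘ T.symm) (T.symm ⁻¹' O₁) :=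
    ha.comp hTss.contDiffOn fun _ h => h
  obtain ⟨b, W₀, hbs, hW₀, h0W₀, hW₀sub, hbeq⟩ := exists_contDiff_eqOn hO₂ hb
    (x := ((0 : E₁), (0 : E₂))) (by
      rw [← hTp, Set.mem_preimage, T.symm_apply_apply]; exact hp₁)
  have hint : TotallyIntegrableOn b W₀ := by
    intro q hq v w
    have hbD : ∀ u, fderiv ℝ b q u = fderiv ℝ a (T.symm q) (ψ u) := fun u => by
      have h1 : HasFDerivAt a (fderiv ℝ a (T.symm q)) (T.symm q) :=
        ((ha.contDiffAt (hO₁.mem_nhds (hW₀sub hq))).differentiableAt (by simp)).hasFDerivAt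
      have h2 : HasFDerivAt T.symm (ψ : E₁ × E₂ →L[ℝ] E) q := by
        rw [show (T.symm : E₁ × E₂ → E) = fun q => ψ q + p from funext hTsymm]
        exact ψ.hasFDerivAt.add_const p
      have h3 := (h1.comp q h2).congr_of_eventuallyEq
        (hbeq.eventuallyEq_of_mem (hW₀.mem_nhds hq))
      rw [h3.fderiv]
      rfl
    rw [hbD, hbD, hbeq hq]
    exact hsymm _ (hW₀sub hq) v w
  obtain ⟨e', he0, heW, hes, hess, hflat⟩ :=
    exists_flat_openPartialHomeomorph_of_graph hbs hW₀ h0W₀ hint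
  let e : OpenPartialHomeomorph E E :=
    (T.transOpenPartialHomeomorph e').transHomeomorph ψ.toHomeomorph
  have hsource : ∀ z, z ∈ e.source ↔ T z ∈ e'.source := fun z => Iff.rfl
  have hecoe : (e : E → E) = fun z => ψ (e' (T z)) := rfl
  refine ⟨e, ?_, ?_, ?_, ?_, LinearMap.ker (LinearMap.snd ℝ E₁ E₂ ∘ₗ (ψ.symm : E →ₗ[ℝ] E₁ × E₂)),
    ?_⟩
  · rw [hsource, hTp]; exact he0
  · intro z hz
    have h1 : T.symm (T z) ∈ O₁ := hW₀sub (heW ((hsource z).1 hz))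
    rw [T.symm_apply_apply] at h1
    exact hO₁O h1
  · exact ψ.contDiff.comp_contDiffOn (hes.comp hTs.contDiffOn fun _ h => h)
  · exact hTss.comp_contDiffOn (hess.comp ψ.symm.contDiff.contDiffOn fun _ h => h)
  · intro z hz u
    have hz' : T z ∈ e'.source := hz
    have h1 : HasFDerivAt e' (fderiv ℝ e' (T z)) (T z) :=
      ((hes.contDiffAt (e'.open_source.mem_nhds hz')).differentiableAt (by simp)).hasFDerivAt
    have h2 := ψ.hasFDerivAt.comp z (h1.comp z (hTderiv z))
    have h3 : fderiv ℝ e z u = ψ (fderiv ℝ e' (T z) (ψ.symm u)) := by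
      have h4 : fderiv ℝ e z = _ := h2.fderiv
      rw [h4]
      rfl
    have h5 : b (T z) = a z := by
      rw [hbeq (heW hz'), Function.comp_apply, T.symm_apply_apply]
    have h6 : z ∈ O₁ := by
      have h7 : T.symm (T z) ∈ O₁ := hW₀sub (heW hz')
      rwa [T.symm_apply_apply] at h7
    rw [h3]
    change _ ↔ (ψ.symm (ψ (fderiv ℝ e' (T z) (ψ.symm u)))).2 = 0
    rw [ψ.symm_apply_apply, hflat _ hz', h5, ← hgraph z h6, ψ.apply_symm_apply]

end Frobenius

/-! ### Curvature of a field of projectors and involutivity of its nullity -/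

section ProjectorCurvature

open VectorField

variable {E : Type*} [NormedAddCommGroup E] [NormedSpace ℝ E]

/-- The curvature `-½[H, H]` of a field `H` of endomorphisms of a vector space. -/
noncomputable def flatCurvature (H : E → E →L[ℝ] E) (x : E) : E →L[ℝ] E →L[ℝ] E :=
  -((fderiv ℝ H x).comp (H x) - ((fderiv ℝ H x).comp (H x)).flip
    + (ContinuousLinearMap.compL ℝ E E E (H x)).comp (fderiv ℝ H x).flip
    - (ContinuousLinearMap.compL ℝ E E E (H x)).comp (fderiv ℝ H x))

theorem flatCurvature_apply (H : E → E →L[ℝ] E) (x u w : E) :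
    flatCurvature H x u w = -(fderiv ℝ H x (H x u) w - fderiv ℝ H x (H x w) u
      + H x (fderiv ℝ H x w u) - H x (fderiv ℝ H x u w)) := rfl

theorem contDiffOn_flatCurvature {H : E → E →L[ℝ] E} {O : Set E} (hO : IsOpen O)
    (hH : ContDiffOn ℝ ∞ H O) : ContDiffOn ℝ ∞ (flatCurvature H) O := by
  have hD : ContDiffOn ℝ ∞ (fderiv ℝ H) O := hH.fderiv_of_isOpen hO (by simp)
  have h1 : ContDiffOn ℝ ∞ (fun x => (fderiv ℝ H x).comp (H x)) O := hD.clm_comp hH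
  have hflip : ∀ {f : E → E →L[ℝ] E →L[ℝ] E}, ContDiffOn ℝ ∞ f O →
      ContDiffOn ℝ ∞ (fun x => (f x).flip) O := fun {f} hf =>
    (ContinuousLinearMap.flipₗᵢ ℝ E E E).contDiff.comp_contDiffOn hf
  have h2 : ContDiffOn ℝ ∞ (fun x => ContinuousLinearMap.compL ℝ E E E (H x)) O :=
    (ContinuousLinearMap.compL ℝ E E E).contDiff.comp_contDiffOn hH
  exact (((h1.sub (hflip h1)).add (h2.clm_comp (hflip hD))).sub (h2.clm_comp hD)).neg

theorem fderiv_clm_apply_field {H : E → E →L[ℝ] E} {X : E → E} {x : E}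
    (hH : DifferentiableAt ℝ H x) (hX : DifferentiableAt ℝ X x) (u : E) :
    fderiv ℝ (fun x => H x (X x)) x u = fderiv ℝ H x u (X x) + H x (fderiv ℝ X x u) := by
  rw [fderiv_clm_apply hH hX]
  simp [add_comm]

/-- The derivatives of `X` and `Y` cancel, leaving only those of `H`. The right-hand side is minus
half the Frölicher–Nijenhuis expression for `[H, H]`. -/
theorem flatCurvature_apply_fields {H : E → E →L[ℝ] E} {X Y : E → E} {x : E}
    (hH : DifferentiableAt ℝ H x) (hX : DifferentiableAt ℝ X x) (hY : DifferentiableAt ℝ Y x) :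
    flatCurvature H x (X x) (Y x) =
      -(lieBracket ℝ (fun x => H x (X x)) (fun x => H x (Y x)) x
        + H x (H x (lieBracket ℝ X Y x)) - H x (lieBracket ℝ (fun x => H x (X x)) Y x)
        - H x (lieBracket ℝ X (fun x => H x (Y x)) x)) := by
  simp only [flatCurvature_apply, lieBracket_eq, fderiv_clm_apply_field hH hX,
    fderiv_clm_apply_field hH hY, map_add, map_sub]
  abel

variable {H : E → E →L[ℝ] E} {O : Set E}

/-- With `HX = X` and `HY = Y` nearby, all four brackets become `[X, Y]`. The curvature thus
measures how far `[X, Y]` is from being horizontal. -/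
theorem flatCurvature_apply_of_fixed (hO : IsOpen O) (hH : ContDiffOn ℝ ∞ H O)
    (hidem : ∀ x ∈ O, ∀ u, H x (H x u) = H x u) {X Y : E → E} (hX : ContDiffOn ℝ ∞ X O)
    (hY : ContDiffOn ℝ ∞ Y O) (hXH : ∀ x ∈ O, H x (X x) = X x) (hYH : ∀ x ∈ O, H x (Y x) = Y x)
    {x : E} (hx : x ∈ O) :
    flatCurvature H x (X x) (Y x) = H x (lieBracket ℝ X Y x) - lieBracket ℝ X Y x := by
  have hOx := hO.mem_nhds hx
  have hX' : (fun x => H x (X x)) =ᶠ[𝓝 x] X := by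
    filter_upwards [hOx] with y hy using hXH y hy
  have hY' : (fun x => H x (Y x)) =ᶠ[𝓝 x] Y := by
    filter_upwards [hOx] with y hy using hYH y hy
  rw [flatCurvature_apply_fields ((hH.contDiffAt hOx).differentiableAt (by simp))
    ((hX.contDiffAt hOx).differentiableAt (by simp))
    ((hY.contDiffAt hOx).differentiableAt (by simp)), hX'.lieBracket_vectorField_eq hY',
    hX'.lieBracket_vectorField_eq (Filter.EventuallyEq.refl _ Y),
    (Filter.EventuallyEq.refl _ X).lieBracket_vectorField_eq hY', hidem x hx]
  abel

/-- The curvature of a field of projectors vanishes on pairs of a fixed and a killed vector. -/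
theorem flatCurvature_apply_fixed_killed (hO : IsOpen O) (hH : ContDiffOn ℝ ∞ H O)
    (hidem : ∀ x ∈ O, ∀ u, H x (H x u) = H x u) {x : E} (hx : x ∈ O) {u w : E}
    (hu : H x u = u) (hw : H x w = 0) : flatCurvature H x u w = 0 := by
  have hOx := hO.mem_nhds hx
  have hHd : DifferentiableAt ℝ H x := (hH.contDiffAt hOx).differentiableAt (by simp)
  -- This is `H² = H` differentiated in the direction `v`. It gives `H (DH_w u) = 0` and `H (DH_u w)
  -- = DH_u w`, after which the curvature terms cancel.
  have key : ∀ v c, fderiv ℝ H x v (H x c) + H x (fderiv ℝ H x v c) = fderiv ℝ H x v c := by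
    intro v c
    have h1 : ∀ c v, fderiv ℝ (fun x => H x c) x v = fderiv ℝ H x v c := fun c v => by
      simpa using fderiv_clm_apply_field hHd (differentiableAt_const c) v
    have h2 : (fun x => H x (H x c)) =ᶠ[𝓝 x] fun x => H x c := by
      filter_upwards [hOx] with y hy using hidem y hy c
    have h3 := fderiv_clm_apply_field hHd (hHd.clm_apply (differentiableAt_const c)) v
    rw [h2.fderiv_eq, h1] at h3
    exact h3.symm
  have h1 := key w u
  have h2 := key u w
  rw [hu, add_eq_left] at h1
  rw [hw, map_zero, zero_add] at h2
  rw [flatCurvature_apply, hu, hw, h1, h2]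
  simp

/-- The nullity distribution of the curvature of a field of projectors is involutive. -/
theorem lieBracket_mem_nullity (hO : IsOpen O) (hH : ContDiffOn ℝ ∞ H O)
    (hidem : ∀ x ∈ O, ∀ u, H x (H x u) = H x u) {X Y : E → E} (hX : ContDiffOn ℝ ∞ X O)
    (hY : ContDiffOn ℝ ∞ Y O) (hXH : ∀ x ∈ O, H x (X x) = X x) (hYH : ∀ x ∈ O, H x (Y x) = Y x)
    (hXR : ∀ x ∈ O, flatCurvature H x (X x) = 0) (hYR : ∀ x ∈ O, flatCurvature H x (Y x) = 0)
    {x : E} (hx : x ∈ O) :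
    H x (lieBracket ℝ X Y x) = lieBracket ℝ X Y x ∧
      flatCurvature H x (lieBracket ℝ X Y x) = 0 := by
  have hbr : ∀ {V W : E → E}, ContDiffOn ℝ ∞ V O → ContDiffOn ℝ ∞ W O →
      ContDiffOn ℝ ∞ (lieBracket ℝ V W) O := fun hV hW =>
    ((hW.fderiv_of_isOpen hO (m := ∞) (by simp)).clm_apply hV).sub
      ((hV.fderiv_of_isOpen hO (m := ∞) (by simp)).clm_apply hW)
  have hfix : ∀ {V Z : E → E}, ContDiffOn ℝ ∞ V O → ContDiffOn ℝ ∞ Z O →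
      (∀ x ∈ O, H x (V x) = V x) → (∀ x ∈ O, H x (Z x) = Z x) →
      (∀ x ∈ O, flatCurvature H x (V x) = 0) →
      ∀ x ∈ O, H x (lieBracket ℝ V Z x) = lieBracket ℝ V Z x := by
    intro V Z hV hZ hVH hZH hVR x hx
    have h1 := flatCurvature_apply_of_fixed hO hH hidem hV hZ hVH hZH hx
    rw [hVR x hx] at h1
    exact sub_eq_zero.1 h1.symm
  have hXYH := hfix hX hY hXH hYH hXR
  refine ⟨hXYH x hx, ?_⟩
  ext c
  -- The vertical part `c - H x c` of a test vector contributes nothing, and the horizontal part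
  -- extends to the horizontal field `x ↦ H x c`.
  have hHc : ContDiffOn ℝ ∞ (fun x => H x c) O := hH.clm_apply contDiffOn_const
  have hZ : ∀ x ∈ O, H x (H x c) = H x c := fun x hx => hidem x hx c
  have hkill : flatCurvature H x (lieBracket ℝ X Y x) (c - H x c) = 0 :=
    flatCurvature_apply_fixed_killed hO hH hidem hx (hXYH x hx) (by
      rw [map_sub, hidem x hx, sub_self])
  rw [map_sub, sub_eq_zero] at hkill
  rw [hkill, flatCurvature_apply_of_fixed hO hH hidem (hbr hX hY) hHc hXYH hZ hx]
  have hat : ∀ {V : E → E}, ContDiffOn ℝ ∞ V O → ContDiffAt ℝ ∞ V x := fun hV =>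
    hV.contDiffAt (hO.mem_nhds hx)
  have hjac := leibniz_identity_lieBracket (n := ∞)
    (by rw [minSmoothness_of_isRCLikeNormedField]; exact ENat.LEInfty.out) (hat hX) (hat hY) (hat hHc)
  -- Both double brackets on the other side of the Jacobi identity are horizontal: a nullity field
  -- is bracketed twice in succession with a horizontal one.
  have h1 := hfix hX (hbr hY hHc) hXH (hfix hY hHc hYH hZ hYR) hXR x hx
  have h2 := hfix hY (hbr hX hHc) hYH (hfix hX hHc hXH hZ hXR) hYR x hx
  rw [eq_sub_of_add_eq hjac.symm, map_sub, h1, h2]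
  simp

end ProjectorCurvature

/-! ### Vector forms and brackets in a chart -/

section ChartRepresentation

open VectorField

variable {E : Type*} [NormedAddCommGroup E] [NormedSpace ℝ E]
  {M : Type*} [TopologicalSpace M] [ChartedSpace E M] [IsManifold 𝓘(ℝ, E) ∞ M]

/-- The derivative at `z` of the preferred chart at `p`. -/
noncomputable def chartDeriv (p z : M) : TangentSpace 𝓘(ℝ, E) z →L[ℝ] E :=
  mfderiv 𝓘(ℝ, E) 𝓘(ℝ, E) (extChartAt 𝓘(ℝ, E) p) z

/-- The expression of a vector `1`-form in the preferred chart at `p`. -/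
noncomputable def chartRep (K : VectorOneForm E M) (p : M) (x : E) : E →L[ℝ] E :=
  (chartDeriv p ((extChartAt 𝓘(ℝ, E) p).symm x)).comp
    ((K ((extChartAt 𝓘(ℝ, E) p).symm x)).comp
      (chartDeriv p ((extChartAt 𝓘(ℝ, E) p).symm x)).inverse)

theorem isInvertible_chartDeriv {p z : M} (hz : z ∈ (extChartAt 𝓘(ℝ, E) p).source) :
    (chartDeriv (E := E) p z).IsInvertible :=
  haveI : IsManifold 𝓘(ℝ, E) 1 M := .of_le (n := ∞) (by simp)
  isInvertible_mfderiv_extChartAt hz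

theorem chartRep_apply (K : VectorOneForm E M) {p z : M}
    (hz : z ∈ (extChartAt 𝓘(ℝ, E) p).source) (u : TangentSpace 𝓘(ℝ, E) z) :
    chartRep K p (extChartAt 𝓘(ℝ, E) p z) (chartDeriv p z u) = chartDeriv p z (K z u) := by
  -- The tangent space depends on the point, so the base point is generalised before identifying it
  -- with `z`.
  have h : ∀ z', z' = z → ∀ v : E, v = chartDeriv p z u →
      chartDeriv p z' (K z' ((chartDeriv p z').inverse v)) = chartDeriv p z (K z u) := by
    rintro _ rfl _ rfl
    rw [(isInvertible_chartDeriv hz).inverse_apply_self]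
  exact h _ ((extChartAt 𝓘(ℝ, E) p).left_inv hz) _ rfl

/-- The vector field on `M` whose expression in the preferred chart at `p` is `V`. -/
noncomputable def chartField (p : M) (V : E → E) : VField E M :=
  mpullback 𝓘(ℝ, E) 𝓘(ℝ, E) (extChartAt 𝓘(ℝ, E) p) V

theorem chartDeriv_chartField {p z : M} (hz : z ∈ (extChartAt 𝓘(ℝ, E) p).source) (V : E → E) :
    chartDeriv p z (chartField p V z) = V (extChartAt 𝓘(ℝ, E) p z) :=
  (isInvertible_chartDeriv hz).self_apply_inverse _

theorem contMDiffAt_extChartAt_of_mem {p z : M} (hz : z ∈ (extChartAt 𝓘(ℝ, E) p).source) :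
    ContMDiffAt 𝓘(ℝ, E) 𝓘(ℝ, E) ∞ (extChartAt 𝓘(ℝ, E) p) z :=
  contMDiffAt_extChartAt' (by rwa [extChartAt_source] at hz)

theorem app_chartField (K : VectorOneForm E M) {p z : M}
    (hz : z ∈ (extChartAt 𝓘(ℝ, E) p).source) (V : E → E) :
    K.app (chartField p V) z = chartField p (fun x => chartRep K p x (V x)) z := by
  apply (isInvertible_chartDeriv hz).injective
  rw [chartDeriv_chartField hz, ← chartDeriv_chartField hz V, chartRep_apply K hz]
  rfl

theorem contMDiffAt_tangentBundle_mk {E : Type*} [NormedAddCommGroup E]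
    [NormedSpace ℝ E] {V : E → E} {x : E} (hV : ContDiffAt ℝ ∞ V x) :
    ContMDiffAt 𝓘(ℝ, E) 𝓘(ℝ, E).tangent ∞ (fun y => (⟨y, V y⟩ : TangentBundle 𝓘(ℝ, E) E)) x :=
  contMDiffWithinAt_univ.1
    ((contMDiffWithinAt_vectorSpace_iff_contDiffWithinAt (V := V) (s := Set.univ)).2
      hV.contDiffWithinAt)

variable [CompleteSpace E]

theorem contMDiffAt_chartField {p z : M} (hz : z ∈ (extChartAt 𝓘(ℝ, E) p).source) {V : E → E}
    (hV : ContDiffAt ℝ ∞ V (extChartAt 𝓘(ℝ, E) p z)) : CMDiffAt ∞ (T% (chartField p V)) z :=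
  haveI : IsManifold 𝓘(ℝ, E) (∞ + 1) M := ‹IsManifold 𝓘(ℝ, E) ∞ M›
  haveI : IsManifold 𝓘(ℝ, E) 1 M := .of_le (n := ∞) (by simp)
  ContMDiffAt.mpullback_vectorField_preimage (n := ∞) (contMDiffAt_tangentBundle_mk hV)
    (contMDiffAt_extChartAt_of_mem hz) (isInvertible_mfderiv_extChartAt hz) (by simp)

theorem chartDeriv_mlieBracket_chartField {p z : M} (hz : z ∈ (extChartAt 𝓘(ℝ, E) p).source)
    {V W : E → E} (hV : ContDiffAt ℝ ∞ V (extChartAt 𝓘(ℝ, E) p z))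
    (hW : ContDiffAt ℝ ∞ W (extChartAt 𝓘(ℝ, E) p z)) :
    chartDeriv p z (mlieBracket 𝓘(ℝ, E) (chartField p V) (chartField p W) z) =
      lieBracket ℝ V W (extChartAt 𝓘(ℝ, E) p z) := by
  have hle : minSmoothness ℝ 2 ≤ ∞ := by
    rw [minSmoothness_of_isRCLikeNormedField]; exact ENat.LEInfty.out
  have : IsManifold 𝓘(ℝ, E) (minSmoothness ℝ 2) M := .of_le hle
  have h := mpullback_mlieBracket (V := V) (W := W)
    ((contMDiffAt_tangentBundle_mk hV).mdifferentiableAt (by simp))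
    ((contMDiffAt_tangentBundle_mk hW).mdifferentiableAt (by simp))
    (contMDiffAt_extChartAt_of_mem hz) hle
  have h2 : mlieBracket 𝓘(ℝ, E) V W = lieBracket ℝ V W :=
    (mlieBracketWithin_univ (V := V) (W := W)).symm.trans
      ((mlieBracketWithin_eq_lieBracketWithin (V := V) (W := W)).trans lieBracketWithin_univ)
  refine (congrArg (chartDeriv p z) h.symm).trans ?_
  rw [h2]
  exact chartDeriv_chartField hz (lieBracket ℝ V W)

/-- In finite dimension it suffices to test on constant vectors `u`: `K` applied to the chart field
of `u` is a smooth section, and the tangent trivialization at `p` reads it through the chart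
derivative. -/
theorem contDiffOn_chartRep [FiniteDimensional ℝ E] (K : VectorOneForm E M) (p : M) :
    ContDiffOn ℝ ∞ (chartRep K p) (extChartAt 𝓘(ℝ, E) p).target := by
  have : IsManifold 𝓘(ℝ, E) 1 M := .of_le (n := ∞) (by simp)
  rw [contDiffOn_clm_apply]
  intro u
  have h1 : ContMDiffOn 𝓘(ℝ, E) 𝓘(ℝ, E) ∞
      (fun z => chartDeriv p z (K.app (chartField p fun _ => u) z))
      (extChartAt 𝓘(ℝ, E) p).source := by
    intro z hz
    have h2 : CMDiffAt ∞ (T% (K.app (chartField p fun _ => u))) z :=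
      ContMDiffAt.clm_bundle_apply (K.contMDiff z) (contMDiffAt_chartField hz contDiffAt_const)
    have hzb : z ∈ (trivializationAt E (TangentSpace 𝓘(ℝ, E)) p).baseSet := by
      rwa [extChartAt_source] at hz
    have h3 := ((trivializationAt E (TangentSpace 𝓘(ℝ, E)) p).contMDiffAt_section_iff hzb).1 h2
    refine (h3.congr_of_eventuallyEq ?_).contMDiffWithinAt
    filter_upwards [(isOpen_extChartAt_source p).mem_nhds hz] with y hy
    have hy' : y ∈ (chartAt E p).source := by rwa [extChartAt_source] at hy
    rw [chartDeriv, ← TangentBundle.continuousLinearMapAt_trivializationAt hy']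
    exact (trivializationAt E (TangentSpace 𝓘(ℝ, E)) p).continuousLinearMapAt_apply_of_mem ℝ hy' _
  have h4 := (h1.comp (contMDiffOn_extChartAt_symm p)
    (extChartAt 𝓘(ℝ, E) p).mapsTo_symm).contDiffOn
  refine h4.congr fun x hx => ?_
  have h5 := (extChartAt 𝓘(ℝ, E) p).map_target hx
  rw [Function.comp_apply, VectorOneForm.app, ← chartRep_apply K h5, chartDeriv_chartField h5,
    (extChartAt 𝓘(ℝ, E) p).right_inv hx]

end ChartRepresentation

/-! ### Transfer to the manifold -/

section Nullity

open VectorField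

variable {E : Type*} [NormedAddCommGroup E] [NormedSpace ℝ E]
  {M : Type*} [TopologicalSpace M] [ChartedSpace E M] [IsManifold 𝓘(ℝ, E) ∞ M]

/-- The linear map whose kernel is the nullity space of the curvature of the field of projectors
`H`. -/
noncomputable def nullityForm (H : E → E →L[ℝ] E) (x : E) : E →L[ℝ] E × (E →L[ℝ] E) :=
  (ContinuousLinearMap.id ℝ E - H x).prod (flatCurvature H x)

theorem nullityForm_apply_eq_zero {H : E → E →L[ℝ] E} {x u : E} :
    nullityForm H x u = 0 ↔ H x u = u ∧ flatCurvature H x u = 0 := by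
  rw [nullityForm, ContinuousLinearMap.prod_apply, Prod.mk_eq_zero, sub_apply, sub_eq_zero,
    ContinuousLinearMap.id_apply, eq_comm]

theorem horProj_apply (Γ : VectorOneForm E M) (z : M) (u : TangentSpace 𝓘(ℝ, E) z) :
    horProj Γ z u = (1 / 2 : ℝ) • (u + Γ z u) := rfl

variable [FiniteDimensional ℝ E]

/-- By tensoriality `u` and `w` may be extended by fields constant in the chart. Each term of the
bracket occurs twice for equal arguments, hence the factor `-2`. -/
theorem chartDeriv_fnBracket_self (K : VectorOneForm E M) {p z : M}
    (hz : z ∈ (extChartAt 𝓘(ℝ, E) p).source) (u w : TangentSpace 𝓘(ℝ, E) z) :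
    chartDeriv p z (fnBracket K K z u w) = (-2 : ℝ) •
      flatCurvature (chartRep K p) (extChartAt 𝓘(ℝ, E) p z) (chartDeriv p z u)
        (chartDeriv p z w) := by
  have : CompleteSpace E := FiniteDimensional.complete ℝ E
  set x := extChartAt 𝓘(ℝ, E) p z with hx
  have hxt : x ∈ (extChartAt 𝓘(ℝ, E) p).target := (extChartAt 𝓘(ℝ, E) p).map_source hz
  set H := chartRep K p with hH
  have hHx : ContDiffAt ℝ ∞ H x :=
    (contDiffOn_chartRep K p).contDiffAt ((isOpen_extChartAt_target p).mem_nhds hxt)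
  have hfield : ∀ v : TangentSpace 𝓘(ℝ, E) z,
      chartField p (fun _ => chartDeriv p z v) z = v := fun v =>
    (isInvertible_chartDeriv hz).injective (chartDeriv_chartField hz _)
  have hV : ∀ c : E, ContDiffAt ℝ ∞ (fun _ : E => c) x := fun c => contDiffAt_const
  have hHV : ∀ c : E, ContDiffAt ℝ ∞ (fun x => H x c) x := fun c => hHx.clm_apply contDiffAt_const
  have happ : ∀ c : E, K.app (chartField p fun _ => c) =ᶠ[𝓝 z] chartField p fun x => H x c :=
    fun c => by
      filter_upwards [(isOpen_extChartAt_source p).mem_nhds hz] with y hy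
      exact app_chartField K hy _
  have hmd : ∀ c : E, MDiffAt (T% (chartField p fun _ => c)) z := fun c =>
    (contMDiffAt_chartField hz (hV c)).mdifferentiableAt (by simp)
  have hK : ∀ v, chartDeriv p z (K z v) = H x (chartDeriv p z v) := fun v =>
    (chartRep_apply K hz v).symm
  set c := chartDeriv p z u with hc
  set d := chartDeriv p z w with hd
  have h1 : fnBracket K K z u w =
      fnBracketField K K (chartField p fun _ => c) (chartField p fun _ => d) z := by
    rw [← fnBracket_apply K K (hmd c) (hmd d), hfield, hfield]
  have hrefl : ∀ c : E, (chartField (M := M) p fun _ => c) =ᶠ[𝓝 z] chartField p fun _ => c :=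
    fun c => Filter.EventuallyEq.refl _ _
  have h2 : flatCurvature H x c d = _ := flatCurvature_apply_fields (X := fun _ => c)
    (Y := fun _ => d) (hHx.differentiableAt (by simp)) (differentiableAt_const c)
    (differentiableAt_const d)
  rw [h1, fnBracketField, (happ c).mlieBracket_vectorField_eq (happ d),
    (happ c).mlieBracket_vectorField_eq (hrefl d), (hrefl c).mlieBracket_vectorField_eq (happ d)]
  simp only [map_add, map_sub, hK, chartDeriv_mlieBracket_chartField hz (hHV c) (hHV d),
    chartDeriv_mlieBracket_chartField hz (hHV c) (hV d),
    chartDeriv_mlieBracket_chartField hz (hV c) (hHV d),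
    chartDeriv_mlieBracket_chartField hz (hV c) (hV d), h2]
  module

theorem chartDeriv_curvature (Γ : VectorOneForm E M) {p z : M}
    (hz : z ∈ (extChartAt 𝓘(ℝ, E) p).source) (u w : TangentSpace 𝓘(ℝ, E) z) :
    chartDeriv p z (curvature Γ z u w) =
      flatCurvature (chartRep (horProj Γ) p) (extChartAt 𝓘(ℝ, E) p z) (chartDeriv p z u)
        (chartDeriv p z w) := by
  have h : curvature Γ z u w = (-(1 / 2) : ℝ) • fnBracket (horProj Γ) (horProj Γ) z u w := by
    rw [neg_smul]; rfl
  rw [h, map_smul, chartDeriv_fnBracket_self _ hz, smul_smul]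
  norm_num

/-- From `LΓ = L`, `Γu - u` lies in `Ker L = Im L`, where `Γ = -I`. So `Γ(Γu - u) = u - Γu`, that is
`Γ² = I`. -/
theorem IsConnection.horProj_idem {L Γ : VectorOneForm E M} (hL : IsAlmostTangent L)
    (hΓ : IsConnection L Γ) (z : M) (u : TangentSpace 𝓘(ℝ, E) z) :
    horProj Γ z (horProj Γ z u) = horProj Γ z u := by
  have hker : Γ z u - u ∈ LinearMap.ker (L z).toLinearMap := by
    have h1 : L z (Γ z u) = L z u := DFunLike.congr_fun (hΓ.comp_left z) u
    change L z (Γ z u - u) = 0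
    rw [map_sub, h1, sub_self]
  rw [← hL.range_eq_ker z] at hker
  obtain ⟨w, hw⟩ := hker
  have hw' : L z w = Γ z u - u := hw
  have h2 : Γ z (L z w) = -L z w := DFunLike.congr_fun (hΓ.comp_right z) w
  rw [hw', map_sub, neg_sub] at h2
  have h3 : Γ z (Γ z u) = u := by
    rw [sub_eq_iff_eq_add] at h2
    simpa using h2
  simp only [horProj_apply, map_smul, map_add, h3]
  module

theorem mem_horSpace_iff {L Γ : VectorOneForm E M} (hL : IsAlmostTangent L)
    (hΓ : IsConnection L Γ) (z : M) (u : TangentSpace 𝓘(ℝ, E) z) :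
    u ∈ horSpace Γ z ↔ horProj Γ z u = u := by
  constructor
  · rintro ⟨v, rfl⟩
    exact hΓ.horProj_idem hL z v
  · exact fun h => ⟨u, h⟩

theorem mem_nullity_iff {L Γ : VectorOneForm E M} (hL : IsAlmostTangent L)
    (hΓ : IsConnection L Γ) {p z : M} (hz : z ∈ (extChartAt 𝓘(ℝ, E) p).source)
    (u : TangentSpace 𝓘(ℝ, E) z) :
    u ∈ nullity Γ z ↔
      nullityForm (chartRep (horProj Γ) p) (extChartAt 𝓘(ℝ, E) p z) (chartDeriv p z u) = 0 := by
  have hinj := (isInvertible_chartDeriv (E := E) hz).injective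
  have hsurj := (isInvertible_chartDeriv (E := E) hz).surjective
  rw [mem_nullity, nullityForm_apply_eq_zero, mem_horSpace_iff hL hΓ, chartRep_apply _ hz,
    hinj.eq_iff]
  refine and_congr_right fun _ => ⟨fun h => ?_, fun h => ?_⟩
  · ext w
    obtain ⟨w, rfl⟩ := hsurj w
    rw [← chartDeriv_curvature Γ hz, h]
    exact map_zero _
  · ext w
    apply hinj
    rw [chartDeriv_curvature Γ hz, h]
    exact (map_zero (chartDeriv p z)).symm

/-- The nullity distribution of the curvature of a connection is completely integrable where its
dimension is constant. -/
theorem nullity_isCompletelyIntegrableOn {L Γ : VectorOneForm E M} (hL : IsAlmostTangent L)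
    (hΓ : IsConnection L Γ) {U : Set M} (hU : IsOpen U) {k : ℕ}
    (hk : ∀ z ∈ U, nullityIndex Γ z = k) : IsCompletelyIntegrableOn (nullity Γ) U := by
  have : CompleteSpace E := FiniteDimensional.complete ℝ E
  have hI1 : IsManifold 𝓘(ℝ, E) 1 M := .of_le (n := ∞) (by simp)
  intro p hp
  set f := extChartAt 𝓘(ℝ, E) p with hf
  have hps : p ∈ f.source := mem_extChartAt_source p
  let O : Set E := f.target ∩ f.symm ⁻¹' U
  have hO : IsOpen O :=
    (continuousOn_extChartAt_symm p).isOpen_inter_preimage (isOpen_extChartAt_target p) hU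
  have hpO : f p ∈ O := ⟨f.map_source hps, by rwa [Set.mem_preimage, f.left_inv hps]⟩
  set H := chartRep (horProj Γ) p with hH
  have hHs : ContDiffOn ℝ ∞ H O := (contDiffOn_chartRep _ p).mono Set.inter_subset_left
  have hpoint : ∀ x ∈ O, ∃ z ∈ f.source, z ∈ U ∧ f z = x := fun x hx =>
    ⟨f.symm x, f.map_target hx.1, hx.2, f.right_inv hx.1⟩
  have hidem : ∀ x ∈ O, ∀ u, H x (H x u) = H x u := by
    intro x hx u
    obtain ⟨z, hz, -, rfl⟩ := hpoint x hx
    obtain ⟨u, rfl⟩ := (isInvertible_chartDeriv (E := E) hz).surjective u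
    rw [hH, chartRep_apply _ hz, chartRep_apply _ hz, hΓ.horProj_idem hL]
  -- The chart derivative is an isomorphism from the nullity space onto this kernel, so constancy of
  -- the nullity index carries over.
  have hdim : ∀ x ∈ O, Module.finrank ℝ (nullityForm H x).ker = k := by
    intro x hx
    obtain ⟨z, hz, hzU, rfl⟩ := hpoint x hx
    obtain ⟨B, hB⟩ := isInvertible_chartDeriv (E := E) hz
    have hmap : (nullityForm H (f z)).ker = (nullity Γ z).map (B.toLinearEquiv : _ →ₗ[ℝ] E) := by
      ext u
      obtain ⟨v, rfl⟩ := B.surjective u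
      have h1 : nullityForm H (f z) (B v) = 0 ↔ v ∈ nullity Γ z := by
        rw [mem_nullity_iff hL hΓ hz, ← hB]
        rfl
      refine h1.trans ⟨fun h => ⟨v, h, rfl⟩, ?_⟩
      rintro ⟨v', hv', h⟩
      rwa [← B.injective h]
    rw [hmap, B.toLinearEquiv.finrank_map_eq, ← hk z hzU, nullityIndex]
  have hform : ContDiffOn ℝ ∞ (nullityForm H) O :=
    contDiffOn_clm_apply.2 fun u =>
      (contDiffOn_const.sub (hHs.clm_apply contDiffOn_const)).prodMk
        ((contDiffOn_flatCurvature hO hHs).clm_apply contDiffOn_const)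
  obtain ⟨e, hpe, heO, hes, hess, S, hS⟩ := exists_flat_openPartialHomeomorph hO hform hdim
    (fun O' hO'O hO' X Y hX hY hXA hYA x hx => by
      simp only [nullityForm_apply_eq_zero] at hXA hYA ⊢
      exact lieBracket_mem_nullity hO' (hHs.mono hO'O) (fun x hx => hidem x (hO'O hx)) hX hY
        (fun x hx => (hXA x hx).1) (fun x hx => (hYA x hx).1)
        (fun x hx => (hXA x hx).2) (fun x hx => (hYA x hx).2) hx) hpO
  have hchart := IsManifold.chart_mem_maximalAtlas (I := 𝓘(ℝ, E)) (n := ∞) (M := M) p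
  have hsrc : ∀ z ∈ ((chartAt E p).trans e).source, z ∈ f.source ∧ f z ∈ e.source := fun z hz => by
    rw [OpenPartialHomeomorph.trans_source] at hz
    exact ⟨by rw [hf, extChartAt_source]; exact hz.1, hz.2⟩
  -- The flat chart is the preferred chart at `p` followed by the flattening of its kernel
  -- distribution.
  refine ⟨(chartAt E p).trans e, ?_, ?_, ?_, S, ?_⟩
  · refine OpenPartialHomeomorph.mem_maximalAtlas_of_contMDiffOn _ ?_ ?_
    · exact hes.contMDiffOn.comp
        ((contMDiffOn_of_mem_maximalAtlas hchart).mono fun z hz => hz.1) fun z hz => hz.2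
    · rw [OpenPartialHomeomorph.trans_target]
      exact (contMDiffOn_symm_of_mem_maximalAtlas hchart).comp
        (hess.contMDiffOn.mono fun z hz => hz.1) fun z hz => hz.2
  · rw [OpenPartialHomeomorph.trans_source]
    exact ⟨mem_chart_source E p, hpe⟩
  · intro z hz
    obtain ⟨hz1, hz2⟩ := hsrc z hz
    have h1 := (heO hz2).2
    rwa [Set.mem_preimage, f.left_inv hz1] at h1
  · intro z hz u
    obtain ⟨hz1, hz2⟩ := hsrc z hz
    have h1 : HasMFDerivAt 𝓘(ℝ, E) 𝓘(ℝ, E) f z (chartDeriv p z) :=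
      ((contMDiffAt_extChartAt_of_mem hz1).mdifferentiableAt (by simp)).hasMFDerivAt
    have h2 : HasFDerivAt e (fderiv ℝ e (f z)) (f z) :=
      ((hes.contDiffAt (e.open_source.mem_nhds hz2)).differentiableAt (by simp)).hasFDerivAt
    have h3 : mfderiv 𝓘(ℝ, E) 𝓘(ℝ, E) ((chartAt E p).trans e) z = _ :=
      (h2.hasMFDerivAt.comp z h1).mfderiv
    rw [mem_nullity_iff hL hΓ hz1, hS _ hz2, h3]
    rfl

end Nullity

end LConn

theorem theorem8 {E : Type*} [NormedAddCommGroup E] [NormedSpace ℝ E] [FiniteDimensional ℝ E]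
    {M : Type*} [TopologicalSpace M] [T2Space M] [ParacompactSpace M]
    [ChartedSpace E M] [IsManifold 𝓘(ℝ, E) ∞ M]
    (L : LConn.VectorOneForm E M) (hL : LConn.IsAlmostTangent L)
    (Γ : LConn.VectorOneForm E M) (hΓ : LConn.IsConnection L Γ)
    (U : Set M) (hU : IsOpen U) (k : ℕ) (hk : ∀ z ∈ U, LConn.nullityIndex Γ z = k) :
    LConn.IsCompletelyIntegrableOn (LConn.nullity Γ) U :=
  LConn.nullity_isCompletelyIntegrableOn hL hΓ hU hk
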